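/- Setting. Let $S=\{s_1,\dots,s_k\}$, $k\ge 2$, let $(\Omega,\mathcal F,\mu)$ be a standard probability space and $\theta:\Omega\to\Omega$ an invertible ergodic $\mu$-preserving transformation. A Markov random network (MRN) $\mathcal X=(X_n)_{n\ge 0}$ is a stochastic process in $S\times\Omega$ with transition probabilities $p_{i,j}(n,\omega)=\mathbb P\{X_n=(s_i,\theta^n\omega)\mid X_0=(s_j,\omega)\}$, not depending on the starting time, which are measurable in $\omega$ and satisfy, for $\mu$-a.e. $\omega$, $\sum_i p_{i,j}(n,\omega)=1$ for all $n,j$ and the Markov property $\mathbb P\{X_{n+1}=(s_{i_{n+1}},\theta^{n+1}\omega)\mid X_0=(s_{i_0},\omega),\dots,X_n=(s_{i_n},\theta^n\omega)\}=p_{i_{n+1},i_n}(1,\theta^n\omega)$. Its transition cocycle is $P_{\mathcal X}(n,\omega)=(p_{i,j}(n,\omega))_{i,j}$. A deterministic random network (DRN) $\mathcal X^0$ is an MRN whose transition cocycle $P^0$ has all entries in $\{0,1\}$ for a.e. $\omega$; let $T(n,\omega):S\to S$ be the map with $T(n,\omega)s_j=s_i$ iff $p^0_{i,j}(n,\omega)=1$.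 The DRN is synchronized if there is a measurable $N:\Omega\to\mathbb N$ such that for a.e. $\omega$ and all $n\ge N(\omega)$ the map $T(n,\omega)$ is constant. A family $\{\mathcal X^\varepsilon\}_{\varepsilon\ge 0}$ of MRN is a Markov perturbation of $\mathcal X^0$ if, for a.e. $\omega$, $|P_{\mathcal X^\varepsilon}(1,\omega)-P^0(1,\omega)|\le\varepsilon$ for all $\varepsilon\ge0$, where $|\cdot|$ is the matrix norm induced by the $\ell^1$-norm on $\mathbb R^k$ (the exceptional null set, including the one in the defining properties of the MRN $\mathcal X^\varepsilon$, is common to all $\varepsilon$). It is $C^m$, $m\ge 1$ an integer, if for some $\varepsilon_0>0$ and a.e. $\omega$ the map $\varepsilon\mapsto P_{\mathcal X^\varepsilon}(1,\omega)$ is $C^m$ on $[0,\varepsilon_0]$. A synchronization index of $\mathcal X^0$ is a measurable $J:\Omega\to\{1,\dots,k\}$ with $P^0(n,\omega)e_{J(\omega)}=e_{J(\theta^n\omega)}$ for a.e. $\omega$ and all $n\ge 0$; a pull-back synchronization time is a measurable $N^-:\Omega\to\mathbb N$ such that, for a.e. $\omega$, $P^0(n,\theta^{-n}\omega)e_j=e_{J(\omega)}$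 for all $j$ and all $n\ge N^-(\omega)$. Given these, let $P^{(\ell)}(n,\omega)$ be the $\ell$-th derivative of $\varepsilon\mapsto P_{\mathcal X^\varepsilon}(n,\omega)$ at $\varepsilon=0$, and, with $\omega^-=\theta^{-N^-(\omega)}\omega$, let $$q^{(0)}(\omega)=e_{J(\omega)},\qquad q^{(\ell)}(\omega)=\sum_{i=0}^{\ell-1}\binom{\ell}{i}P^{(\ell-i)}(N^-(\omega),\omega^-)\,q^{(i)}(\omega^-)\quad(1\le\ell\le m),$$ and $\Omega_{\rm deg}=\{q^{(1)}=0\}\cap\dots\cap\{q^{(m)}=0\}$. Theorem C. Let $\{\mathcal X^\varepsilon\}$ be a $C^m$-Markov perturbation ($m\ge 1$) of a synchronized DRN $\mathcal X^0$. Then a synchronization index $J$ and a pull-back synchronization time $N^-$ exist, and for every choice of them the following holds. If $\mu(\Omega_{\rm deg})<1$, then there are $0<a<1$ and $\ell\in\{1,\dots,m\}$ such that for every sufficiently small $\delta>0$ there exist $\varepsilon_\delta>0$, $b_\delta>0$, $c_\delta>0$ and $E_\delta,F_\delta:\Omega\to 2^{\mathbb N}$ such that for $\mu$-a.e. $\omega$: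 (i) $E_\delta(\omega)$ and $F_\delta(\omega)$ are disjoint, and $$\liminf_{n\to\infty}\frac{\#(E_\delta(\omega)\cap\{1,\dots,n\})}{n}>a-\delta,\qquad \liminf_{n\to\infty}\frac{\#(F_\delta(\omega)\cap\{1,\dots,n\})}{n}>1-a-\delta;$$ (ii) for every $0\le\varepsilon<\varepsilon_\delta$ and any two independent copies $\mathcal X,\mathcal Y$ of $\mathcal X^\varepsilon$, with arbitrary (possibly different) initial distributions on $S\times\{\omega\}$, $$\mathbb P\{X_n=Y_n\mid X_0,Y_0\in S\times\{\omega\}\}\ge 1-\varepsilon^\ell b_\delta\quad\forall n\in E_\delta(\omega),$$ $$\mathbb P\{X_n\ne Y_n\mid X_0,Y_0\in S\times\{\omega\}\}\ge \varepsilon^\ell c_\delta\quad\forall n\in F_\delta(\omega).$$ -/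

import Mathlib

open MeasureTheory Set Filter
open scoped NNReal ENNReal Matrix

noncomputable section

/-- A trajectory in the state space `S × Ω`, where `S = {s_1, …, s_k}` is modelled by `Fin k`. -/
abbrev Trajectory (k : ℕ) (Ω : Type*) : Type _ := ℕ → Fin k × Ω

variable {Ω : Type*} [MeasurableSpace Ω]

/-- The properties of a Markov random network along one noise realization `ω`.
Here `law (j, ω)` is the conditional distribution of the process `(X_n)` given `X_0 = (s_j, ω)`.
The conditional probability of an event for `X_n` given `X_m = (s_j, ω')` is that of the same
event for `X_(n-m)` given `X_0 = (s_j, ω')`. -/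
structure MarkovAlong {k : ℕ} (θ : Ω ≃ᵐ Ω) (law : Fin k × Ω → Measure (Trajectory k Ω))
    (ω : Ω) : Prop where
  /-- Given `X_0 = (s_j, ω)`, the process starts at `(s_j, ω)`. -/
  start : ∀ j : Fin k, law (j, ω) {x | x 0 = (j, ω)} = 1
  /-- The process is stochastic over `θ`. -/
  stochastic : ∀ (j : Fin k) (n : ℕ), ∑ i : Fin k, law (j, ω) {x | x n = (i, θ^[n] ω)} = 1
  /-- The Markov property: given `X_0 = (s_(i 0), ω), …, X_n = (s_(i n), θ^n ω)`, the event
  `X_(n+1) = (s_(i (n+1)), θ^(n+1) ω)` has the conditional probability that it has given only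
  `X_n = (s_(i n), θ^n ω)` (multiplied by the probability of the conditioning event). -/
  markov : ∀ (n : ℕ) (i : ℕ → Fin k),
    law (i 0, ω) {x | ∀ t ≤ n + 1, x t = (i t, θ^[t] ω)} =
      law (i 0, ω) {x | ∀ t ≤ n, x t = (i t, θ^[t] ω)} *
        law (i n, θ^[n] ω) {x | x 1 = (i (n + 1), θ (θ^[n] ω))}

/-- A Markov random network (MRN) with `k` states over `(Ω, μ, θ)`, given by the conditional
distributions of the process `(X_n)` in `S × Ω` given `X_0 = (s_j, ω)`. -/
structure MRN (k : ℕ) (μ : Measure Ω) (θ : Ω ≃ᵐ Ω) where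
  law : Fin k × Ω → Measure (Trajectory k Ω)
  isProbabilityMeasure : ∀ z, IsProbabilityMeasure (law z)
  measurable : ∀ (n : ℕ) (i j : Fin k), Measurable fun ω => law (j, ω) {x | x n = (i, θ^[n] ω)}
  markovAlong : ∀ᵐ ω ∂μ, MarkovAlong θ law ω

namespace MRN

variable {k : ℕ} {μ : Measure Ω} {θ : Ω ≃ᵐ Ω}

/-- The transition cocycle: `P(n, ω)_{i,j}` is the probability of `X_n = (s_i, θ^n ω)`
given `X_0 = (s_j, ω)`. -/
def cocycle (X : MRN k μ θ) (n : ℕ) (ω : Ω) : Matrix (Fin k) (Fin k) ℝ :=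
  Matrix.of fun i j => (X.law (j, ω)).real {x | x n = (i, θ^[n] ω)}

/-- The network is deterministic (a DRN): all transition probabilities are `0` or `1`. -/
def IsDeterministic (X : MRN k μ θ) : Prop :=
  ∀ᵐ ω ∂μ, ∀ (n : ℕ) (i j : Fin k), X.cocycle n ω i j = 0 ∨ X.cocycle n ω i j = 1

/-- The maps `T(n, ω) : S → S` of a DRN: `T(n, ω) s_j = s_i` iff `P(n, ω)_{i,j} = 1`. -/
def stateMap (X : MRN k μ θ) (n : ℕ) (ω : Ω) (j : Fin k) : Fin k :=
  @Classical.epsilon (Fin k) ⟨j⟩ fun i => X.cocycle n ω i j = 1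

/-- A DRN is synchronized: from a finite measurable time on, all states are mapped to one. -/
def IsSynchronized (X : MRN k μ θ) : Prop :=
  ∃ N : Ω → ℕ, Measurable N ∧
    ∀ᵐ ω ∂μ, ∀ n, N ω ≤ n → ∀ i j : Fin k, X.stateMap n ω i = X.stateMap n ω j

/-- `J` is a synchronization index: `P(n, ω) e_{J(ω)} = e_{J(θ^n ω)}`. -/
def IsSyncIndex (X : MRN k μ θ) (J : Ω → Fin k) : Prop :=
  Measurable J ∧ ∀ᵐ ω ∂μ, ∀ n : ℕ,
    X.cocycle n ω *ᵥ Pi.single (J ω) 1 = Pi.single (J (θ^[n] ω)) 1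

/-- `N` is a pull-back synchronization time: `P(n, θ^{-n} ω) e_j = e_{J(ω)}` for `n ≥ N(ω)`. -/
def IsPullbackSyncTime (X : MRN k μ θ) (J : Ω → Fin k) (N : Ω → ℕ) : Prop :=
  Measurable N ∧ ∀ᵐ ω ∂μ, ∀ (j : Fin k) (n : ℕ), N ω ≤ n →
    X.cocycle n (θ.symm^[n] ω) *ᵥ Pi.single j 1 = Pi.single (J ω) 1

/-- The conditional distribution of the process given `X_0 ∈ S × {ω}`, when the conditional
distribution of the initial state on the fibre `S × {ω}` is the probability vector `π`. -/
def fibreLaw (X : MRN k μ θ) (π : Fin k → ℝ) (ω : Ω) : Measure (Trajectory k Ω) :=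
  ∑ j : Fin k, ENNReal.ofReal (π j) • X.law (j, ω)

/-- Probability of `X_n = Y_n` given `X_0, Y_0 ∈ S × {ω}`, for two independent copies of the MRN
with initial distributions `π` and `π'` on the fibre `S × {ω}`. -/
def syncProb (X : MRN k μ θ) (π π' : Fin k → ℝ) (ω : Ω) (n : ℕ) : ℝ :=
  ((X.fibreLaw π ω).prod (X.fibreLaw π' ω)).real {z | z.1 n = z.2 n}

/-- Probability of `X_n ≠ Y_n` given `X_0, Y_0 ∈ S × {ω}`, for two independent copies of the MRN
with initial distributions `π` and `π'` on the fibre `S × {ω}`. -/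
def desyncProb (X : MRN k μ θ) (π π' : Fin k → ℝ) (ω : Ω) (n : ℕ) : ℝ :=
  ((X.fibreLaw π ω).prod (X.fibreLaw π' ω)).real {z | z.1 n ≠ z.2 n}

end MRN

/-- The norm on `k × k` matrices induced by the `ℓ¹`-norm: the maximal absolute column sum. -/
def l1OpNorm {k : ℕ} (A : Matrix (Fin k) (Fin k) ℝ) : ℝ :=
  ⨆ j : Fin k, ∑ i : Fin k, |A i j|

variable {k : ℕ} {μ : Measure Ω} {θ : Ω ≃ᵐ Ω}

/-- The family `X ε`, `ε ≥ 0`, is a Markov perturbation of `X₀`. As the family is studied along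
one and the same noise realization `ω` for all `ε`, the exceptional null set is common to all `ε`,
in the bound and in the defining properties of the networks. -/
structure IsMarkovPerturbation (X : ℝ≥0 → MRN k μ θ) (X₀ : MRN k μ θ) : Prop where
  markovAlong : ∀ᵐ ω ∂μ, ∀ ε : ℝ≥0, MarkovAlong θ (X ε).law ω
  bound : ∀ᵐ ω ∂μ, ∀ ε : ℝ≥0, l1OpNorm ((X ε).cocycle 1 ω - X₀.cocycle 1 ω) ≤ ε

/-- The family is `C^m`: for some `ε₀ > 0` and almost every `ω`, all entries of `P_ε(1, ω)` are
`C^m` functions of `ε` on `[0, ε₀]`. -/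
def IsContDiffFamily (m : ℕ) (X : ℝ≥0 → MRN k μ θ) : Prop :=
  ∃ ε₀ : ℝ, 0 < ε₀ ∧ ∀ᵐ ω ∂μ, ∀ i j : Fin k,
    ContDiffOn ℝ m (fun ε : ℝ => (X ε.toNNReal).cocycle 1 ω i j) (Icc 0 ε₀)

/-- The `ℓ`-th (one-sided) derivative of `ε ↦ P_ε(n, ω)` at `ε = 0`. -/
def cocycleDeriv (X : ℝ≥0 → MRN k μ θ) (ℓ n : ℕ) (ω : Ω) : Matrix (Fin k) (Fin k) ℝ :=
  Matrix.of fun i j =>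
    iteratedDerivWithin ℓ (fun ε : ℝ => (X ε.toNNReal).cocycle n ω i j) (Ici 0) 0

/-- The coefficient functions `q^(ℓ)`: `q^(0)(ω) = e_{J(ω)}`, and for `ℓ ≥ 1`, with
`ω⁻ = θ^{-N(ω)} ω`, `q^(ℓ)(ω) = ∑_{i < ℓ} (ℓ choose i) P^(ℓ-i)(N(ω), ω⁻) q^(i)(ω⁻)`. -/
def qCoeff (X : ℝ≥0 → MRN k μ θ) (J : Ω → Fin k) (N : Ω → ℕ) : ℕ → Ω → Fin k → ℝ
  | 0, ω => Pi.single (J ω) 1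
  | ℓ + 1, ω => ∑ i : Fin (ℓ + 1), ((ℓ + 1).choose i : ℝ) •
      (cocycleDeriv X (ℓ + 1 - i) (N ω) (θ.symm^[N ω] ω) *ᵥ
        qCoeff X J N i (θ.symm^[N ω] ω))
  termination_by ℓ => ℓ
  decreasing_by exact i.isLt

/-- The set of complete degeneracy, `{q^(1) = 0} ∩ … ∩ {q^(m) = 0}`. -/
def degenerateSet (X : ℝ≥0 → MRN k μ θ) (J : Ω → Fin k) (N : Ω → ℕ) (m : ℕ) : Set Ω :=
  {ω | ∀ ℓ, 1 ≤ ℓ → ℓ ≤ m → qCoeff X J N ℓ ω = 0}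

/-- The lower density `liminf #(E ∩ {1, …, n}) / n` of a set of times. -/
def lowerDensity (E : Set ℕ) : ℝ :=
  liminf (fun n : ℕ => ((E ∩ Icc 1 n).ncard : ℝ) / n) atTop

end

/-!
The proof follows the laws of the perturbed networks along pulled back orbits.

Synchronization is a property of `P⁰(n, ω)` that holds with a probability tending to one, and `θ`
preserves `μ`, so that it also occurs along almost every pulled back orbit. This gives the index `J`
and the time `N` (`exists_isSyncIndex_isPullbackSyncTime`).

Let `ℓ` be the first order for which `q^(ℓ)` does not vanish almost everywhere. For almost every
`ω`, the column `J(ω⁻)` of `P_ε(N(ω), ω⁻)` is `e_{J(ω)} + ε^ℓ q^(ℓ)(ω) / ℓ! + o(ε^ℓ)` by Taylor's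
theorem. At `ε = 0` the matrix `P_ε(N(ω), ω⁻)` maps all vectors of zero sum to `0`, so an error of
order `ε^r` in the law at `ω⁻` becomes an error of order `ε^(r+1)` at `ω`. Going back `ℓ + 1` times
through `ω ↦ ω⁻` therefore yields the same expansion for all columns of `P_ε(L, θ^{-L} ω)`, for some
`L` that depends on `ω` (`exists_isLittleO_cocycle`). By the Markov property the law at `ω` is an
average of these columns whenever the network was started at least `L` steps before, so two-sided
bounds on the columns hold uniformly in the starting time and in the initial distribution
(`MRN.sum_cocycle_mul_mem_Icc`). The coordinate `J(ω)` of the law is thus at least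
`1 - O(ε^ℓ)`; where `q^(ℓ)(ω) ≠ 0` it is also at most `1 - c ε^ℓ` with some `c > 0`, as the leading
coefficient of a curve of probability vectors that starts at `e_J` has a negative coordinate `J`
(`leading_coeff_neg`).

For rational `ε` these bounds define measurable sets of `ω`, which grow with the constants to a set
of full measure and to a set of positive measure `α`. By a one-sided ergodic theorem the orbit
visits them with the expected frequencies (`ae_linearlyDense_visits`, from the maximal ergodic
theorem). If `α < 1`, then `a = 1 - α`, and `E` only uses visits outside the set of measure `α`; if
`α = 1`, then `a = 1 / 2`, and `E` and `F` are separated by the parity of the time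
(`exists_disjoint_visit_times`). Finally, two independent copies agree with a probability of at
least `p_J p'_J`, and differ with a probability of at least `p_J (1 - p'_J)`.
-/

noncomputable section

variable {Ω : Type*} [MeasurableSpace Ω] {k : ℕ} {μ : Measure Ω} {θ : Ω ≃ᵐ Ω}

/-! ### Densities of sets of times -/

/-- `E` has at least `c * n - K` elements in `{1, …, n}`, for some constant `K` and all `n`. This
is slightly stronger than having lower density at least `c`, and behaves additively. -/
def LinearlyDense (c : ℝ) (E : Set ℕ) : Prop :=
  ∃ K : ℝ, ∀ n : ℕ, c * n - K ≤ ((E ∩ Icc 1 n).ncard : ℝ)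

theorem LinearlyDense.le_lowerDensity {c : ℝ} {E : Set ℕ} (h : LinearlyDense c E) :
    c ≤ lowerDensity E := by
  obtain ⟨K, hK⟩ := h
  have hlim : Tendsto (fun n : ℕ => c - K / n) atTop (nhds c) := by
    simpa using tendsto_const_nhds.sub (tendsto_const_div_atTop_nhds_zero_nat K)
  have hle : ∀ n : ℕ, ((E ∩ Icc 1 n).ncard : ℝ) / n ≤ 1 := by
    intro n
    refine div_le_one_of_le₀ ?_ n.cast_nonneg
    have := ncard_le_ncard (inter_subset_right : E ∩ Icc 1 n ⊆ Icc 1 n) (finite_Icc 1 n)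
    simp only [← Finset.coe_Icc, ncard_coe_finset, Nat.card_Icc, add_tsub_cancel_right] at this
    simpa using (Nat.cast_le (α := ℝ)).2 this
  rw [← hlim.liminf_eq]
  refine liminf_le_liminf ?_ hlim.isBoundedUnder_ge
    (isCoboundedUnder_ge_of_le atTop hle)
  filter_upwards [eventually_gt_atTop 0] with n hn
  have hn' : (0 : ℝ) < n := by exact_mod_cast hn
  rw [le_div_iff₀ hn', sub_mul, div_mul_cancel₀ _ hn'.ne']
  exact hK n

theorem LinearlyDense.inter {c d : ℝ} {E D : Set ℕ} (hE : LinearlyDense c E)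
    (hD : LinearlyDense d D) : LinearlyDense (c + d - 1) (E ∩ D) := by
  obtain ⟨K, hK⟩ := hE
  obtain ⟨K', hK'⟩ := hD
  refine ⟨K + K', fun n => ?_⟩
  have hf : (Icc 1 n).Finite := finite_Icc 1 n
  have h1 := ncard_union_add_ncard_inter (E ∩ Icc 1 n) (D ∩ Icc 1 n) (hf.inter_of_right _)
    (hf.inter_of_right _)
  have h2 : ((E ∩ Icc 1 n) ∪ (D ∩ Icc 1 n)).ncard ≤ n := by
    have := ncard_le_ncard (union_subset inter_subset_right inter_subset_right :
      (E ∩ Icc 1 n) ∪ (D ∩ Icc 1 n) ⊆ Icc 1 n) hf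
    simpa only [← Finset.coe_Icc, ncard_coe_finset, Nat.card_Icc, add_tsub_cancel_right] using this
  rw [← inter_inter_distrib_right] at h1
  have h1' : (((E ∩ Icc 1 n) ∪ (D ∩ Icc 1 n)).ncard : ℝ) + ((E ∩ D ∩ Icc 1 n).ncard : ℝ) =
    (E ∩ Icc 1 n).ncard + (D ∩ Icc 1 n).ncard := by exact_mod_cast h1
  have h2' : (((E ∩ Icc 1 n) ∪ (D ∩ Icc 1 n)).ncard : ℝ) ≤ n := by exact_mod_cast h2
  linarith [hK n, hK' n]

theorem linearlyDense_Ici (L : ℕ) : LinearlyDense 1 (Ici L) := by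
  refine ⟨L, fun n => ?_⟩
  have h : Ioc L n ⊆ Ici L ∩ Icc 1 n := fun x hx => ⟨hx.1.le, by have := hx.1; simp; omega, hx.2⟩
  have h1 := ncard_le_ncard h ((finite_Icc 1 n).inter_of_right _)
  simp only [← Finset.coe_Ioc, ncard_coe_finset, Nat.card_Ioc] at h1
  have h2 : n ≤ (Ici L ∩ Icc 1 n).ncard + L := by omega
  have : (n : ℝ) ≤ (Ici L ∩ Icc 1 n).ncard + L := by exact_mod_cast h2
  linarith

/-- A set of times that contains all even, or all odd, positive times has density at least
`1 / 2`. -/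
theorem linearlyDense_half {E : Set ℕ} (r : ℕ) (hr : 1 ≤ r) (hr' : r ≤ 2)
    (hE : ∀ i, 2 * i + r ∈ E) : LinearlyDense (1 / 2) E := by
  refine ⟨1, fun n => ?_⟩
  have h : (fun i => 2 * i + r) '' Iio (n / 2) ⊆ E ∩ Icc 1 n := by
    rintro _ ⟨i, hi, rfl⟩
    refine ⟨hE i, ?_⟩
    simp only [mem_Iio, mem_Icc] at hi ⊢
    omega
  have h1 := ncard_le_ncard h ((finite_Icc 1 n).inter_of_right _)
  rw [ncard_image_of_injective _ (fun a b hab => by simpa using hab), ← Finset.coe_Iio,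
    ncard_coe_finset, Nat.card_Iio] at h1
  have h2 : n ≤ 2 * (E ∩ Icc 1 n).ncard + 1 := by omega
  have : (n : ℝ) ≤ 2 * (E ∩ Icc 1 n).ncard + 1 := by exact_mod_cast h2
  linarith

/-! ### Visits of an ergodic transformation to a set -/

/-- The maximum of `0` and of the Birkhoff sums of `f` of lengths `1, …, n`. -/
def maxBirkhoffSum (T : Ω → Ω) (f : Ω → ℝ) : ℕ → Ω → ℝ
  | 0, _ => 0
  | n + 1, ω => max 0 (f ω + maxBirkhoffSum T f n (T ω))

section maximal

variable {T : Ω → Ω} {f : Ω → ℝ}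

theorem maxBirkhoffSum_nonneg {α : Type*} {T : α → α} {f : α → ℝ} (n : ℕ) (ω : α) :
    0 ≤ maxBirkhoffSum T f n ω := by
  cases n with
  | zero => simp [maxBirkhoffSum]
  | succ n => exact le_max_left _ _

theorem maxBirkhoffSum_le_succ {α : Type*} {T : α → α} {f : α → ℝ} (n : ℕ) (ω : α) :
    maxBirkhoffSum T f n ω ≤ maxBirkhoffSum T f (n + 1) ω := by
  induction n generalizing ω with
  | zero => exact le_max_left _ _
  | succ n ih => exact max_le_max le_rfl (add_le_add le_rfl (ih (T ω)))

theorem birkhoffSum_le_maxBirkhoffSum {α : Type*} {T : α → α} {f : α → ℝ} (n : ℕ)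
    (ω : α) :
    birkhoffSum T f n ω ≤ maxBirkhoffSum T f n ω := by
  induction n generalizing ω with
  | zero => simp [maxBirkhoffSum]
  | succ n ih =>
    rw [birkhoffSum_succ']
    exact (add_le_add le_rfl (ih (T ω))).trans (le_max_right _ _)

theorem measurable_maxBirkhoffSum (hT : Measurable T) (hf : Measurable f) (n : ℕ) :
    Measurable (maxBirkhoffSum T f n) := by
  induction n with
  | zero => exact measurable_const
  | succ n ih => exact measurable_const.max (hf.add (ih.comp hT))

theorem integrable_maxBirkhoffSum (hT : MeasurePreserving T μ μ) (hf : Integrable f μ)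
    (n : ℕ) : Integrable (maxBirkhoffSum T f n) μ := by
  induction n with
  | zero => exact integrable_zero _ _ _
  | succ n ih =>
    exact (integrable_zero _ _ _).sup (hf.add (hT.integrable_comp_of_integrable ih))

/-- The maximal ergodic theorem. -/
theorem setIntegral_maxBirkhoffSum_pos_nonneg (hT : MeasurePreserving T μ μ) (hfm : Measurable f)
    (hf : Integrable f μ) (n : ℕ) : 0 ≤ ∫ ω in {ω | 0 < maxBirkhoffSum T f n ω}, f ω ∂μ := by
  have hm := measurable_maxBirkhoffSum hT.measurable hfm
  have hi := integrable_maxBirkhoffSum hT hf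
  have hs : MeasurableSet {ω | 0 < maxBirkhoffSum T f n ω} :=
    measurableSet_lt measurable_const (hm n)
  rw [← integral_indicator hs]
  have h0 : ∫ ω, (maxBirkhoffSum T f n ω - maxBirkhoffSum T f n (T ω)) ∂μ = 0 := by
    have hsub : ∫ ω, (maxBirkhoffSum T f n ω - maxBirkhoffSum T f n (T ω)) ∂μ =
        ∫ ω, maxBirkhoffSum T f n ω ∂μ - ∫ ω, maxBirkhoffSum T f n (T ω) ∂μ :=
      integral_sub (hi n) (hT.integrable_comp_of_integrable (hi n))
    rw [hsub, sub_eq_zero]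
    have := integral_map (μ := μ) hT.aemeasurable (f := maxBirkhoffSum T f n)
      (hm n).aestronglyMeasurable
    rwa [hT.map_eq] at this
  refine h0.symm.trans_le (integral_mono ((hi n).sub (hT.integrable_comp_of_integrable (hi n)))
    (hf.indicator hs) fun ω => ?_)
  by_cases hω : 0 < maxBirkhoffSum T f n ω
  · rw [indicator_of_mem (show ω ∈ {ω | 0 < maxBirkhoffSum T f n ω} from hω)]
    cases n with
    | zero => simp [maxBirkhoffSum] at hω
    | succ n =>
      have h1 : maxBirkhoffSum T f (n + 1) ω = f ω + maxBirkhoffSum T f n (T ω) := by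
        rcases max_choice 0 (f ω + maxBirkhoffSum T f n (T ω)) with h | h
        · exact absurd h hω.ne'
        · exact h
      linarith [maxBirkhoffSum_le_succ (T := T) (f := f) n (T ω)]
  · rw [indicator_of_notMem (show ω ∉ {ω | 0 < maxBirkhoffSum T f n ω} from hω)]
    linarith [maxBirkhoffSum_nonneg (T := T) (f := f) n (T ω)]

/-- The Birkhoff sums of a function with negative integral are bounded above almost everywhere. -/
theorem ae_exists_birkhoffSum_le (hT : Ergodic T μ) (hfm : Measurable f)
    (hf : Integrable f μ) (hneg : ∫ ω, f ω ∂μ < 0) :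
    ∀ᵐ ω ∂μ, ∃ K : ℝ, ∀ n, birkhoffSum T f n ω ≤ K := by
  have hm := measurable_maxBirkhoffSum hT.measurable hfm
  set B : Set Ω := {ω | ∀ K : ℕ, ∃ n, (K : ℝ) < maxBirkhoffSum T f n ω} with hB
  have hBm : MeasurableSet B := by
    simp only [hB, ofPred_forall, ofPred_exists]
    exact .iInter fun K => .iUnion fun n => measurableSet_lt measurable_const (hm n)
  have hinv : T ⁻¹' B = B := by
    ext ω
    constructor
    · intro h K
      obtain ⟨K', hK'⟩ := exists_nat_gt (K - f ω)
      obtain ⟨n, hn⟩ := h K'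
      exact ⟨n + 1, lt_max_of_lt_right (by linarith)⟩
    · intro h K
      obtain ⟨K', hK'⟩ := exists_nat_gt (K + |f ω|)
      obtain ⟨n, hn⟩ := h K'
      cases n with
      | zero =>
        simp only [maxBirkhoffSum] at hn
        exact absurd hn (by simp)
      | succ n =>
        refine ⟨n, ?_⟩
        rcases lt_max_iff.1 hn with h' | h'
        · exact absurd h' (by simp)
        · linarith [le_abs_self (f ω)]
  rcases hT.toPreErgodic.ae_mem_or_ae_notMem hBm hinv with h | h
  · exfalso
    have hmono : Monotone fun n => {ω | 0 < maxBirkhoffSum T f n ω} :=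
      monotone_nat_of_le_succ fun n ω hω => lt_of_lt_of_le hω (maxBirkhoffSum_le_succ n ω)
    have hlim := tendsto_setIntegral_of_monotone (μ := μ) (f := f)
      (fun n => measurableSet_lt measurable_const (hm n)) hmono hf.integrableOn
    have hU : (⋃ n, {ω | 0 < maxBirkhoffSum T f n ω}) =ᵐ[μ] univ := by
      rw [eventuallyEq_univ]
      filter_upwards [h] with ω hω
      obtain ⟨n, hn⟩ := hω 0
      exact mem_iUnion.2 ⟨n, by simpa using hn⟩
    rw [setIntegral_congr_set hU, setIntegral_univ] at hlim
    exact hneg.not_ge (ge_of_tendsto' hlim fun n =>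
      setIntegral_maxBirkhoffSum_pos_nonneg hT.toMeasurePreserving hfm hf n)
  · filter_upwards [h] with ω hω
    simp only [hB, mem_ofPred_eq, not_forall, not_exists, not_lt] at hω
    obtain ⟨K, hK⟩ := hω
    exact ⟨K, fun n => (birkhoffSum_le_maxBirkhoffSum n ω).trans (hK n)⟩

end maximal

/-- One half of Birkhoff's ergodic theorem for the visits to a set. -/
theorem ae_linearlyDense_visits [IsProbabilityMeasure μ] {T : Ω → Ω} (hT : Ergodic T μ)
    {A : Set Ω} (hA : MeasurableSet A) {c : ℝ} (hc : c < μ.real A) :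
    ∀ᵐ ω ∂μ, LinearlyDense c {n | T^[n] ω ∈ A} := by
  have hfm : Measurable fun ω => c - A.indicator (fun _ => (1 : ℝ)) ω :=
    measurable_const.sub (measurable_const.indicator hA)
  have hi : Integrable (A.indicator fun _ => (1 : ℝ)) μ := (integrable_const _).indicator hA
  have hneg : ∫ ω, (c - A.indicator (fun _ => (1 : ℝ)) ω) ∂μ < 0 := by
    rw [integral_sub (integrable_const _) hi, integral_indicator hA]
    simpa using hc
  classical
  filter_upwards [ae_exists_birkhoffSum_le hT hfm ((integrable_const _).sub hi) hneg]
    with ω ⟨K, hK⟩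
  refine ⟨K + 1 + |c|, fun n => ?_⟩
  have h1 := hK (n + 1)
  have h2 : birkhoffSum T (fun ω => c - A.indicator (fun _ => (1 : ℝ)) ω) (n + 1) ω =
      (n + 1) * c - ({t ∈ Finset.range (n + 1) | T^[t] ω ∈ A}.card : ℝ) := by
    simp only [birkhoffSum, Finset.sum_sub_distrib, Finset.sum_const, Finset.card_range,
      nsmul_eq_mul, indicator_apply, Finset.sum_boole]
    push_cast
    rfl
  -- The Birkhoff sum also counts the time `0`, which is not in `Icc 1 n`.
  have h3 : {t ∈ Finset.range (n + 1) | T^[t] ω ∈ A}.card ≤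
      ({n | T^[n] ω ∈ A} ∩ Icc 1 n).ncard + 1 := by
    rw [← ncard_coe_finset]
    refine le_trans (ncard_le_ncard (t := insert 0 ({n | T^[n] ω ∈ A} ∩ Icc 1 n)) ?_
      (((finite_Icc 1 n).inter_of_right _).insert 0)) (ncard_insert_le _ _)
    intro t ht
    simp only [Finset.coe_filter, Finset.mem_range, mem_ofPred_eq] at ht
    rcases Nat.eq_zero_or_pos t with h | h
    · exact Or.inl h
    · exact Or.inr ⟨ht.2, h, by omega⟩
  have h3' : ({t ∈ Finset.range (n + 1) | T^[t] ω ∈ A}.card : ℝ) ≤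
      ({n | T^[n] ω ∈ A} ∩ Icc 1 n).ncard + 1 := by exact_mod_cast h3
  rw [h2] at h1
  linarith [neg_abs_le c]

theorem measurableSet_eventually_mem {s : ℕ → Set Ω} (hs : ∀ n, MeasurableSet (s n)) :
    MeasurableSet {ω | ∀ᶠ n in atTop, ω ∈ s n} := by
  simp only [eventually_atTop, ofPred_exists, ofPred_forall]
  exact .iUnion fun a => .iInter fun n => .iInter fun _ => hs n

theorem eventually_lt_measureReal_inter [IsFiniteMeasure μ] {s : ℕ → Set Ω} {c : ℝ}
    (hc : c < μ.real {ω | ∀ᶠ n in atTop, ω ∈ s n}) :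
    ∀ᶠ n in atTop, c < μ.real (s n ∩ {ω | ∀ᶠ n in atTop, ω ∈ s n}) := by
  have hmono : Monotone fun n => {ω | ∀ p, n ≤ p → ω ∈ s p} :=
    fun a b hab ω hω p hp => hω p (hab.trans hp)
  have hU : (⋃ n, {ω | ∀ p, n ≤ p → ω ∈ s p}) = {ω | ∀ᶠ n in atTop, ω ∈ s n} := by
    ext ω
    simp [eventually_atTop]
  have hlim := (ENNReal.tendsto_toReal (measure_ne_top μ _)).comp
    (tendsto_measure_iUnion_atTop (μ := μ) hmono)
  rw [hU] at hlim
  filter_upwards [hlim.eventually_const_lt hc] with n hn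
  exact lt_of_lt_of_le hn (measureReal_mono fun ω hω =>
    ⟨hω n le_rfl, eventually_atTop.2 ⟨n, hω⟩⟩)

/-- If the sets `A n` exhaust `Ω` and the sets `G n` exhaust a set that is not null, then almost
every orbit has disjoint sets `E`, `F` of late times at which it visits `A L`, respectively `G L`,
and the lower densities of `E` and `F` nearly add up to one. -/
theorem exists_disjoint_visit_times [IsProbabilityMeasure μ] {T : Ω → Ω} (hT : Ergodic T μ)
    {A G : ℕ → Set Ω} (hAm : ∀ n, MeasurableSet (A n)) (hGm : ∀ n, MeasurableSet (G n))
    (hA : ∀ᵐ ω ∂μ, ∀ᶠ n in atTop, ω ∈ A n) (hG : ¬ ∀ᵐ ω ∂μ, ¬ ∀ᶠ n in atTop, ω ∈ G n) :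
    ∃ a : ℝ, 0 < a ∧ a < 1 ∧ ∀ δ : ℝ, 0 < δ → ∃ (L : ℕ) (E F : Ω → Set ℕ), ∀ᵐ ω ∂μ,
      Disjoint (E ω) (F ω) ∧ a - δ < lowerDensity (E ω) ∧ 1 - a - δ < lowerDensity (F ω) ∧
      (∀ n ∈ E ω, L ≤ n ∧ T^[n] ω ∈ A L) ∧ (∀ n ∈ F ω, L ≤ n ∧ T^[n] ω ∈ G L) := by
  set W : Set Ω := {ω | ∀ᶠ n in atTop, ω ∈ G n} with hW
  have hWm : MeasurableSet W := measurableSet_eventually_mem hGm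
  have hWpos : 0 < μ.real W := by
    refine (measureReal_nonneg).lt_of_ne' fun h => hG ?_
    rw [measureReal_eq_zero_iff] at h
    exact measure_eq_zero_iff_ae_notMem.1 h
  have hA1 : μ.real {ω | ∀ᶠ n in atTop, ω ∈ A n} = 1 := by
    rw [measureReal_def, prob_compl_eq_zero_iff (measurableSet_eventually_mem hAm) |>.1
      (mem_ae_iff.1 hA)]
    simp
  have hAL : ∀ c : ℝ, c < 1 → ∀ᶠ n in atTop, c < μ.real (A n) := fun c hc => by
    filter_upwards [eventually_lt_measureReal_inter (μ := μ) (s := A) (hc.trans_eq hA1.symm)]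
      with n hn
    exact hn.trans_le (measureReal_mono inter_subset_left)
  have hGL : ∀ c : ℝ, c < μ.real W → ∀ᶠ n in atTop, c < μ.real (G n ∩ W) :=
    fun c hc => eventually_lt_measureReal_inter hc
  rcases (measureReal_le_one (μ := μ) (s := W)).lt_or_eq with hlt | heq
  · refine ⟨1 - μ.real W, by linarith, by linarith, fun δ hδ => ?_⟩
    obtain ⟨L, h1, h2⟩ := ((hAL (1 - δ / 2) (by linarith)).and
      (hGL (μ.real W - δ / 2) (by linarith))).exists
    refine ⟨L, fun ω => {n | T^[n] ω ∈ A L \ W} ∩ Ici L,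
      fun ω => {n | T^[n] ω ∈ G L ∩ W} ∩ Ici L, ?_⟩
    have h1' : 1 - μ.real W - δ / 2 < μ.real (A L \ W) := by
      have := le_measureReal_sdiff (μ := μ) (s₁ := A L) (s₂ := W)
      linarith
    filter_upwards [ae_linearlyDense_visits hT ((hAm L).diff hWm) h1',
      ae_linearlyDense_visits hT ((hGm L).inter hWm) h2] with ω hE hF
    refine ⟨?_, ?_, ?_, fun n hn => ⟨hn.2, hn.1.1⟩, fun n hn => ⟨hn.2, hn.1.1⟩⟩
    · exact disjoint_left.2 fun n hn hn' => hn.1.2 hn'.1.2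
    · have := (hE.inter (linearlyDense_Ici L)).le_lowerDensity
      linarith
    · have := (hF.inter (linearlyDense_Ici L)).le_lowerDensity
      linarith
  · -- No room for `E` is left outside `W`, so the times are split by parity.
    refine ⟨1 / 2, by norm_num, by norm_num, fun δ hδ => ?_⟩
    obtain ⟨L, h1, h2⟩ := ((hAL (1 - δ / 2) (by linarith)).and
      (hGL (1 - δ / 2) (by linarith))).exists
    have h2' := h2.trans_le (measureReal_mono (inter_subset_left : G L ∩ W ⊆ G L))
    refine ⟨L, fun ω => {n | T^[n] ω ∈ A L} ∩ {n | Even n} ∩ Ici L,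
      fun ω => {n | T^[n] ω ∈ G L} ∩ {n | Odd n} ∩ Ici L, ?_⟩
    have heven : LinearlyDense (1 / 2) {n | Even n} :=
      linearlyDense_half 2 (by norm_num) le_rfl fun i => ⟨i + 1, by ring⟩
    have hodd : LinearlyDense (1 / 2) {n | Odd n} :=
      linearlyDense_half 1 le_rfl (by norm_num) fun i => ⟨i, rfl⟩
    filter_upwards [ae_linearlyDense_visits hT (hAm L) h1,
      ae_linearlyDense_visits hT (hGm L) h2'] with ω hE hF
    refine ⟨?_, ?_, ?_, fun n hn => ⟨hn.2, hn.1.1⟩, fun n hn => ⟨hn.2, hn.1.1⟩⟩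
    · exact disjoint_left.2 fun n hn hn' => Nat.not_even_iff_odd.2 hn'.1.2 hn.1.2
    · have := ((hE.inter heven).inter (linearlyDense_Ici L)).le_lowerDensity
      linarith
    · have := ((hF.inter hodd).inter (linearlyDense_Ici L)).le_lowerDensity
      linarith

/-! ### The transition cocycle of a Markov random network -/

theorem measurableSet_state_eq [MeasurableSingletonClass Ω] (n : ℕ)
    (z : Fin k × Ω) :
    MeasurableSet {x : Trajectory k Ω | x n = z} :=
  (measurableSet_singleton z).preimage (measurable_pi_apply n)

/-- An event is decomposed along the finitely many values of the first `n` states. -/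
theorem measureReal_eq_sum_paths (ν : Measure (Trajectory k Ω)) [IsFiniteMeasure ν] (n : ℕ)
    (B : Set (Trajectory k Ω)) :
    ν.real B = ∑ c : Fin n → Fin k, ν.real ({x | ∀ t : Fin n, (x t).1 = c t} ∩ B) := by
  have hg : Measurable fun (x : Trajectory k Ω) (t : Fin n) => (x t).1 := by fun_prop
  have h1 := sum_measure_preimage_singleton (μ := ν.restrict B) Finset.univ
    (f := fun (x : Trajectory k Ω) (t : Fin n) => (x t).1)
    (fun c _ => hg (measurableSet_singleton c))
  simp only [Finset.coe_univ, preimage_univ, Measure.restrict_apply_univ] at h1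
  rw [measureReal_def, ← h1, ENNReal.toReal_sum fun c _ => measure_ne_top _ _]
  refine Finset.sum_congr rfl fun c _ => ?_
  rw [Measure.restrict_apply (hg (measurableSet_singleton c)), measureReal_def]
  congr 2
  ext x
  simp [funext_iff]

namespace MarkovAlong

variable {X : MRN k μ θ} {ω : Ω}

theorem sum_cocycle (h : MarkovAlong θ X.law ω) (n : ℕ) (j : Fin k) :
    ∑ i, X.cocycle n ω i j = 1 := by
  have := X.isProbabilityMeasure (j, ω)
  have h1 := congrArg ENNReal.toReal (h.stochastic j n)
  rwa [ENNReal.toReal_sum fun i _ => measure_ne_top _ _, ENNReal.toReal_one] at h1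

variable [MeasurableSingletonClass Ω]

theorem ae_fst_zero (h : MarkovAlong θ X.law ω) (j : Fin k) :
    ∀ᵐ x ∂X.law (j, ω), (x 0).1 = j := by
  have := X.isProbabilityMeasure (j, ω)
  filter_upwards [mem_ae_iff.2 ((prob_compl_eq_zero_iff (measurableSet_state_eq 0 _)).2
    (h.start j))] with x hx
  exact congrArg Prod.fst hx

theorem ae_snd (h : MarkovAlong θ X.law ω) (j : Fin k) :
    ∀ᵐ x ∂X.law (j, ω), ∀ n, (x n).2 = θ^[n] ω := by
  have := X.isProbabilityMeasure (j, ω)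
  rw [ae_all_iff]
  intro n
  have h1 : X.law (j, ω) (⋃ i ∈ Finset.univ, {x | x n = (i, θ^[n] ω)}) = 1 := by
    rw [measure_biUnion_finset, h.stochastic j n]
    · intro a _ b _ hab
      exact disjoint_left.2 fun x hx hx' => hab (congrArg Prod.fst (hx.symm.trans hx'))
    · exact fun i _ => measurableSet_state_eq n _
  filter_upwards [mem_ae_iff.2 ((prob_compl_eq_zero_iff
    (.biUnion (to_countable _) fun i _ => measurableSet_state_eq n _)).2 h1)] with x hx
  obtain ⟨i, -, hi⟩ := mem_iUnion₂.1 hx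
  exact congrArg Prod.snd hi

theorem cocycle_eq (h : MarkovAlong θ X.law ω) (n : ℕ) (i j : Fin k) :
    X.cocycle n ω i j = (X.law (j, ω)).real {x | (x n).1 = i} := by
  refine measureReal_congr ?_
  filter_upwards [h.ae_snd j] with x hx
  exact propext ⟨fun hi => congrArg Prod.fst hi, fun hi => Prod.ext hi (hx n)⟩

theorem cocycle_zero (h : MarkovAlong θ X.law ω) : X.cocycle 0 ω = 1 := by
  ext i j
  have := X.isProbabilityMeasure (j, ω)
  rw [h.cocycle_eq, Matrix.one_apply]
  split_ifs with hij
  · rw [← probReal_univ (μ := X.law (j, ω))]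
    refine measureReal_congr ?_
    filter_upwards [h.ae_fst_zero j] with x hx
    exact propext ⟨fun _ => trivial, fun _ => hx.trans hij.symm⟩
  · rw [measureReal_def, measure_eq_zero_iff_ae_notMem.2, ENNReal.toReal_zero]
    filter_upwards [h.ae_fst_zero j] with x hx hx'
    exact hij (hx'.symm.trans hx)

/-- The Markov property for the first coordinates of a path. The event is the set of paths that
follow `c` up to time `n + 1`. -/
theorem measureReal_path_succ (h : MarkovAlong θ X.law ω) (j : Fin k) (n : ℕ) (c : ℕ → Fin k) :
    (X.law (j, ω)).real {x | ∀ t ≤ n + 1, (x t).1 = c t} =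
      X.cocycle 1 (θ^[n] ω) (c (n + 1)) (c n) *
        (X.law (j, ω)).real {x | ∀ t ≤ n, (x t).1 = c t} := by
  by_cases hj : c 0 = j
  · subst hj
    have key : ∀ m, (X.law (c 0, ω)).real {x | ∀ t ≤ m, (x t).1 = c t} =
        (X.law (c 0, ω)).real {x | ∀ t ≤ m, x t = (c t, θ^[t] ω)} := by
      intro m
      refine measureReal_congr ?_
      filter_upwards [h.ae_snd (c 0)] with x hx
      exact propext ⟨fun hi t ht => Prod.ext (hi t ht) (hx t),
        fun hi t ht => congrArg Prod.fst (hi t ht)⟩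
    rw [key, key, mul_comm, measureReal_def, h.markov n c, ENNReal.toReal_mul]
    rfl
  · have key : ∀ m, (X.law (j, ω)).real {x | ∀ t ≤ m, (x t).1 = c t} = 0 := by
      intro m
      rw [measureReal_def, measure_eq_zero_iff_ae_notMem.2, ENNReal.toReal_zero]
      filter_upwards [h.ae_fst_zero j] with x hx hx'
      exact hj ((hx' 0 (Nat.zero_le _)).symm.trans hx)
    rw [key, key, mul_zero]

theorem cocycle_succ (h : MarkovAlong θ X.law ω) (n : ℕ) :
    X.cocycle (n + 1) ω = X.cocycle 1 (θ^[n] ω) * X.cocycle n ω := by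
  ext i j
  have := X.isProbabilityMeasure (j, ω)
  rw [Matrix.mul_apply, h.cocycle_eq]
  have h1 := sum_measureReal_preimage_singleton
    (μ := (X.law (j, ω)).restrict {x | (x (n + 1)).1 = i})
    Finset.univ (f := fun x : Trajectory k Ω => (x n).1)
    (fun c _ => (by fun_prop : Measurable fun x : Trajectory k Ω => (x n).1)
      (measurableSet_singleton c))
  simp only [Finset.coe_univ, preimage_univ, measureReal_restrict_apply_univ] at h1
  rw [← h1]
  refine Finset.sum_congr rfl fun s _ => ?_
  rw [measureReal_restrict_apply ((by fun_prop : Measurable fun x : Trajectory k Ω => (x n).1)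
    (measurableSet_singleton s)), h.cocycle_eq, measureReal_eq_sum_paths _ n,
    measureReal_eq_sum_paths _ n {x | (x n).1 = s}, Finset.mul_sum]
  refine Finset.sum_congr rfl fun c _ => ?_
  -- The path that follows `c` before time `n`, and is at `s`, `i` at the times `n`, `n + 1`.
  let d : ℕ → Fin k := fun t => if ht : t < n then c ⟨t, ht⟩ else if t = n then s else i
  have hd : ∀ t : Fin n, d t = c t := fun t => by simp [d]
  have hdn : d n = s := by simp [d]
  have hdn' : d (n + 1) = i := by simp [d]
  have hpath : {x : Trajectory k Ω | ∀ t ≤ n, (x t).1 = d t} =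
      {x | ∀ t : Fin n, (x t).1 = c t} ∩ {x | (x n).1 = s} := by
    ext x
    refine ⟨fun hx => ⟨fun t => (hx t t.2.le).trans (hd t), (hx n le_rfl).trans hdn⟩, ?_⟩
    rintro ⟨hx, hx'⟩ t ht
    rcases ht.lt_or_eq with ht | rfl
    · exact (hx ⟨t, ht⟩).trans (hd ⟨t, ht⟩).symm
    · exact Eq.trans hx' hdn.symm
  have hpath' : {x : Trajectory k Ω | ∀ t ≤ n + 1, (x t).1 = d t} =
      {x | ∀ t ≤ n, (x t).1 = d t} ∩ {x | (x (n + 1)).1 = i} := by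
    ext x
    refine ⟨fun hx => ⟨fun t ht => hx t (by omega), (hx (n + 1) le_rfl).trans hdn'⟩, ?_⟩
    rintro ⟨hx, hx'⟩ t ht
    rcases ht.lt_or_eq with ht | rfl
    · exact hx t (by omega)
    · exact Eq.trans hx' hdn'.symm
  have := h.measureReal_path_succ j n d
  rw [hpath', hpath, hdn, hdn', inter_assoc] at this
  exact this

theorem cocycle_add {m : ℕ} (h : MarkovAlong θ X.law ω) (h' : MarkovAlong θ X.law (θ^[m] ω))
    (n : ℕ) : X.cocycle (n + m) ω = X.cocycle n (θ^[m] ω) * X.cocycle m ω := by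
  induction n with
  | zero => rw [h'.cocycle_zero, zero_add, one_mul]
  | succ n ih =>
    rw [add_right_comm, h.cocycle_succ, ih, h'.cocycle_succ, Matrix.mul_assoc,
      Function.iterate_add_apply]

end MarkovAlong

theorem iterate_symm_iterate (n : ℕ) (ω : Ω) : θ^[n] (θ.symm^[n] ω) = ω :=
  (Function.LeftInverse.iterate θ.apply_symm_apply n) ω

theorem symm_iterate_iterate (n : ℕ) (ω : Ω) : θ.symm^[n] (θ^[n] ω) = ω :=
  (Function.LeftInverse.iterate θ.symm_apply_apply n) ω

theorem iterate_symm_iterate_add (n m : ℕ) (ω : Ω) :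
    θ^[m] (θ.symm^[n + m] ω) = θ.symm^[n] ω := by
  rw [add_comm, Function.iterate_add_apply, iterate_symm_iterate]

namespace MRN

variable {X : MRN k μ θ} {ω : Ω}

theorem cocycle_nonneg (X : MRN k μ θ) (n : ℕ) (ω : Ω) (i j : Fin k) : 0 ≤ X.cocycle n ω i j :=
  measureReal_nonneg

theorem measurable_cocycle (X : MRN k μ θ) (n : ℕ) (i j : Fin k) :
    Measurable fun ω => X.cocycle n ω i j :=
  (X.measurable n i j).ennreal_toReal

theorem isProbabilityMeasure_fibreLaw (X : MRN k μ θ) {π : Fin k → ℝ}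
    (hπ : π ∈ stdSimplex ℝ (Fin k)) (ω : Ω) : IsProbabilityMeasure (X.fibreLaw π ω) := by
  refine ⟨?_⟩
  have h : ∀ j, X.law (j, ω) univ = 1 := fun j => (X.isProbabilityMeasure _).measure_univ
  simp only [fibreLaw, Measure.coe_finsetSum, Finset.sum_apply, Measure.smul_apply, h,
    smul_eq_mul, mul_one]
  rw [← ENNReal.ofReal_sum_of_nonneg fun j _ => hπ.1 j, hπ.2, ENNReal.ofReal_one]

theorem fibreLaw_real_state (X : MRN k μ θ) {π : Fin k → ℝ} (hπ : π ∈ stdSimplex ℝ (Fin k))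
    (ω : Ω) (n : ℕ) (i : Fin k) :
    (X.fibreLaw π ω).real {x | x n = (i, θ^[n] ω)} = ∑ j, X.cocycle n ω i j * π j := by
  have h := fun z => X.isProbabilityMeasure z
  simp only [measureReal_def, fibreLaw, Measure.coe_finsetSum, Finset.sum_apply,
    Measure.smul_apply, smul_eq_mul]
  rw [ENNReal.toReal_sum fun j _ => ENNReal.mul_ne_top ENNReal.ofReal_ne_top (measure_ne_top _ _)]
  refine Finset.sum_congr rfl fun j _ => ?_
  rw [ENNReal.toReal_mul, ENNReal.toReal_ofReal (hπ.1 j), mul_comm]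
  rfl

theorem mul_le_syncProb (X : MRN k μ θ) {π π' : Fin k → ℝ} (hπ : π ∈ stdSimplex ℝ (Fin k))
    (hπ' : π' ∈ stdSimplex ℝ (Fin k)) (ω : Ω) (n : ℕ) (i : Fin k) :
    (∑ j, X.cocycle n ω i j * π j) * (∑ j, X.cocycle n ω i j * π' j) ≤
      X.syncProb π π' ω n := by
  have := X.isProbabilityMeasure_fibreLaw hπ ω
  have := X.isProbabilityMeasure_fibreLaw hπ' ω
  rw [← X.fibreLaw_real_state hπ, ← X.fibreLaw_real_state hπ', ← measureReal_prod_prod]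
  exact measureReal_mono fun z hz => Eq.trans hz.1 (Eq.symm hz.2)

variable [MeasurableSingletonClass Ω]

theorem mul_le_desyncProb (X : MRN k μ θ) {π π' : Fin k → ℝ} (hπ : π ∈ stdSimplex ℝ (Fin k))
    (hπ' : π' ∈ stdSimplex ℝ (Fin k)) (ω : Ω) (n : ℕ) (i : Fin k) :
    (∑ j, X.cocycle n ω i j * π j) * (1 - ∑ j, X.cocycle n ω i j * π' j) ≤
      X.desyncProb π π' ω n := by
  have := X.isProbabilityMeasure_fibreLaw hπ ω
  have := X.isProbabilityMeasure_fibreLaw hπ' ω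
  rw [← X.fibreLaw_real_state hπ, ← X.fibreLaw_real_state hπ',
    ← probReal_compl_eq_one_sub (measurableSet_state_eq n _), ← measureReal_prod_prod]
  exact measureReal_mono fun z hz h => hz.2 (Eq.trans (Eq.symm h) hz.1)

theorem cocycle_pullback_add (h : ∀ n, MarkovAlong θ X.law (θ.symm^[n] ω)) (n m : ℕ) :
    X.cocycle (n + m) (θ.symm^[n + m] ω) =
      X.cocycle n (θ.symm^[n] ω) * X.cocycle m (θ.symm^[n + m] ω) := by
  have h' : MarkovAlong θ X.law (θ^[m] (θ.symm^[n + m] ω)) := by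
    rw [iterate_symm_iterate_add]
    exact h n
  rw [(h _).cocycle_add h', iterate_symm_iterate_add]

/-- By the Markov property, the law of `X_n` is an average of the columns of
`P(L, θ^{-L} θ^n ω)`, for any `L ≤ n`. -/
theorem sum_cocycle_mul_mem_Icc {a b : ℝ} {i : Fin k} {L n : ℕ} (hLn : L ≤ n)
    (h : ∀ n, MarkovAlong θ X.law (θ.symm^[n] ω))
    (hab : ∀ j, X.cocycle L (θ.symm^[L] ω) i j ∈ Icc a b) {π : Fin k → ℝ}
    (hπ : π ∈ stdSimplex ℝ (Fin k)) :
    ∑ j, X.cocycle n (θ.symm^[n] ω) i j * π j ∈ Icc a b := by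
  obtain ⟨m, rfl⟩ := Nat.exists_eq_add_of_le hLn
  have h1 : ∀ j, X.cocycle (L + m) (θ.symm^[L + m] ω) i j ∈ Icc a b := by
    intro j
    rw [cocycle_pullback_add h, Matrix.mul_apply]
    have h2 := (convex_Icc a b).sum_mem (t := Finset.univ)
      (fun s _ => X.cocycle_nonneg m (θ.symm^[L + m] ω) s j) ((h _).sum_cocycle m j)
      (fun s _ => hab s)
    simpa only [smul_eq_mul, mul_comm] using h2
  have h2 := (convex_Icc a b).sum_mem (t := Finset.univ) (fun s _ => hπ.1 s) hπ.2
    (fun s _ => h1 s)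
  simpa only [smul_eq_mul, mul_comm] using h2

theorem cocycle_mem_Icc_of_le {a b : ℝ} {i : Fin k} {L n : ℕ} (hLn : L ≤ n)
    (h : ∀ n, MarkovAlong θ X.law (θ.symm^[n] ω))
    (hab : ∀ j, X.cocycle L (θ.symm^[L] ω) i j ∈ Icc a b) (j : Fin k) :
    X.cocycle n (θ.symm^[n] ω) i j ∈ Icc a b := by
  have h1 := sum_cocycle_mul_mem_Icc hLn h hab (single_mem_stdSimplex ℝ j)
  simpa only [Pi.single_apply, mul_ite, mul_one, mul_zero, Finset.sum_ite_eq', Finset.sum_ite_eq,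
    Finset.mem_univ, if_true] using h1

end MRN

/-! ### One-sided expansions in a small parameter -/

open Asymptotics Topology

theorem iteratedDerivWithin_Icc_left_eq_Ici {f : ℝ → ℝ} {b : ℝ} (hb : 0 < b) (n : ℕ) :
    iteratedDerivWithin n f (Icc 0 b) 0 = iteratedDerivWithin n f (Ici 0) 0 := by
  have h : (Icc 0 b : Set ℝ) =ᶠ[𝓝 0] Ici 0 := by
    filter_upwards [Iio_mem_nhds hb] with x hx
    exact propext ⟨fun h => h.1, fun h => ⟨h, le_of_lt hx⟩⟩
  rw [iteratedDerivWithin, iteratedDerivWithin, iteratedFDerivWithin_congr_set h]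

/-- Taylor's theorem at the left end point of an interval, for a function whose derivatives of
the orders `1, …, ℓ - 1` vanish there. -/
theorem isLittleO_sub_of_iteratedDerivWithin_eq_zero {f : ℝ → ℝ} {b : ℝ} (hb : 0 < b) {ℓ : ℕ}
    (hℓ : 1 ≤ ℓ) (hf : ContDiffOn ℝ ℓ f (Icc 0 b))
    (h0 : ∀ i, 1 ≤ i → i < ℓ → iteratedDerivWithin i f (Ici 0) 0 = 0) :
    (fun ε => f ε - f 0 - ε ^ ℓ * (iteratedDerivWithin ℓ f (Ici 0) 0 / ℓ.factorial))
      =o[𝓝[≥] 0] fun ε => ε ^ ℓ := by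
  have h := taylor_isLittleO (convex_Icc 0 b) (left_mem_Icc.2 hb.le) hf
  rw [nhdsWithin_Icc_eq_nhdsGE hb] at h
  simp only [sub_zero] at h
  refine h.congr_left fun ε => ?_
  obtain ⟨n, rfl⟩ : ∃ n, ℓ = n + 1 := ⟨ℓ - 1, by omega⟩
  rw [taylor_within_apply, Finset.sum_range_succ, Finset.sum_range_succ',
    Finset.sum_eq_zero fun i hi => ?_]
  · simp only [iteratedDerivWithin_Icc_left_eq_Ici hb, iteratedDerivWithin_zero, smul_eq_mul,
      sub_zero, Nat.factorial_zero, Nat.cast_one, inv_one, pow_zero, mul_one, one_mul, zero_add]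
    ring
  · rw [iteratedDerivWithin_Icc_left_eq_Ici hb, h0 (i + 1) (by omega)
      (by have := Finset.mem_range.1 hi; omega), smul_zero]

/-- If `A 0` maps all probability vectors to `e_J`, then the columns of `A ε * B ε` are determined
by the column `J'` of `A ε` with one order more precision than the columns of `B ε` by
`e_(J')`. -/
theorem isBigO_mul_sub_column {A B : ℝ → Matrix (Fin k) (Fin k) ℝ} {J J' : Fin k} {h : ℕ}
    (hA0 : ∀ i s, A 0 i s = if i = J then 1 else 0)
    (hA : ∀ i s, (fun ε => A ε i s - A 0 i s) =O[𝓝[≥] 0] fun ε => ε)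
    (hB : ∀ i s, (fun ε => B ε i s - if i = J' then 1 else 0) =O[𝓝[≥] 0] fun ε => ε ^ h)
    (hB1 : ∀ ε j, ∑ i, B ε i j = 1) (i j : Fin k) :
    (fun ε => (A ε * B ε) i j - A ε i J') =O[𝓝[≥] 0] fun ε => ε ^ (h + 1) := by
  have hsum : ∀ ε, (A ε * B ε) i j - A ε i J' =
      ∑ s, (A ε i s - A 0 i s) * (B ε s j - if s = J' then 1 else 0) := by
    intro ε
    simp only [hA0, sub_mul, mul_sub, Finset.sum_sub_distrib, mul_ite, mul_one, mul_zero,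
      ← Finset.mul_sum, hB1, Finset.sum_ite_eq', Finset.mem_univ, if_true, Matrix.mul_apply]
    simp
  simp only [hsum]
  refine IsBigO.fun_sum fun s _ => ?_
  simpa only [pow_succ'] using (hA i s).mul (hB s j)

/-- The leading coefficient of a curve of probability vectors that starts at a vertex `e_J`
points into the simplex. -/
theorem leading_coeff_neg {p : ℝ → Fin k → ℝ} {J : Fin k} {c : Fin k → ℝ} {ℓ : ℕ}
    (hp : ∀ ε i, 0 ≤ p ε i) (hp1 : ∀ ε, ∑ i, p ε i = 1)
    (h : ∀ i, (fun ε => p ε i - (if i = J then 1 else 0) - ε ^ ℓ * c i)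
      =o[𝓝[≥] 0] fun ε => ε ^ ℓ) (hc : c ≠ 0) : c J < 0 := by
  have hlim : ∀ i, Tendsto (fun ε => (p ε i - if i = J then 1 else 0) / ε ^ ℓ) (𝓝[>] 0)
      (𝓝 (c i)) := by
    intro i
    have h1 := ((h i).mono (nhdsWithin_mono _ Ioi_subset_Ici_self)).tendsto_div_nhds_zero
    have h2 := h1.add_const (c i)
    rw [zero_add] at h2
    refine h2.congr' ?_
    filter_upwards [self_mem_nhdsWithin] with ε hε
    have : ε ^ ℓ ≠ 0 := pow_ne_zero _ (ne_of_gt hε)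
    field_simp
    ring
  have hnonneg : ∀ i, i ≠ J → 0 ≤ c i := by
    intro i hi
    refine ge_of_tendsto (hlim i) ?_
    filter_upwards [self_mem_nhdsWithin] with ε hε
    rw [if_neg hi, sub_zero]
    exact div_nonneg (hp ε i) (pow_nonneg (le_of_lt hε) _)
  have hsum : ∑ i, c i = 0 := by
    refine tendsto_nhds_unique (tendsto_finsetSum _ fun i _ => hlim i) ?_
    refine tendsto_const_nhds.congr fun ε => ?_
    rw [← Finset.sum_div, Finset.sum_sub_distrib, hp1]
    simp
  rw [← Finset.add_sum_erase _ _ (Finset.mem_univ J)] at hsum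
  have hrest : 0 ≤ ∑ i ∈ Finset.univ.erase J, c i :=
    Finset.sum_nonneg fun i hi => hnonneg i (Finset.ne_of_mem_erase hi)
  refine lt_of_le_of_ne (by linarith) fun hJ => hc (funext fun i => ?_)
  by_cases hi : i = J
  · rw [hi, hJ]; rfl
  · rw [hJ, zero_add] at hsum
    exact (Finset.sum_eq_zero_iff_of_nonneg fun i hi =>
      hnonneg i (Finset.ne_of_mem_erase hi)).1 hsum i (Finset.mem_erase.2 ⟨hi, Finset.mem_univ i⟩)

/-! ### Expansion of the transition cocycle along a pulled back orbit -/

/-- The properties of a noise realization `ω` that are used, along its whole backward orbit, to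
expand `P_ε(n, θ^{-n} ω)` at `ε = 0` up to the order `ℓ`. They hold almost everywhere if `ℓ` is
the first order for which `q^(ℓ)` does not vanish almost everywhere. -/
structure IsExpandable (X : ℝ≥0 → MRN k μ θ) (J : Ω → Fin k) (N : Ω → ℕ) (ε₀ : ℝ) (ℓ : ℕ)
    (ω : Ω) : Prop where
  markovAlong : ∀ ε, MarkovAlong θ (X ε).law ω
  contDiffOn : ∀ i j, ContDiffOn ℝ ℓ (fun ε : ℝ => (X ε.toNNReal).cocycle 1 ω i j) (Icc 0 ε₀)
  cocycle_zero : ∀ i j, (X 0).cocycle (N ω) (θ.symm^[N ω] ω) i j = if i = J ω then 1 else 0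
  qCoeff_eq_zero : ∀ i, 1 ≤ i → i < ℓ → qCoeff X J N i ω = 0

section expansion

variable {X : ℝ≥0 → MRN k μ θ} {J : Ω → Fin k} {N : Ω → ℕ}
  {ε₀ : ℝ} {ℓ : ℕ} {ω : Ω}

/-- If the lower coefficients vanish at `ω⁻`, only the term `i = 0` of the sum defining
`q^(n)(ω)` is left. -/
theorem qCoeff_eq_iteratedDerivWithin {n : ℕ} (hn : 1 ≤ n)
    (h0 : ∀ i, 1 ≤ i → i < n → qCoeff X J N i (θ.symm^[N ω] ω) = 0) (i : Fin k) :
    qCoeff X J N n ω i = iteratedDerivWithin n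
      (fun ε : ℝ => (X ε.toNNReal).cocycle (N ω) (θ.symm^[N ω] ω) i (J (θ.symm^[N ω] ω)))
      (Ici 0) 0 := by
  obtain ⟨n, rfl⟩ : ∃ n', n = n' + 1 := ⟨n - 1, by omega⟩
  rw [qCoeff, Fin.sum_univ_succ, Finset.sum_eq_zero fun s _ => ?_]
  · simp [qCoeff, cocycleDeriv]
  · rw [h0 _ (by simp) (by simp), Matrix.mulVec_zero, smul_zero]

variable [MeasurableSingletonClass Ω]

theorem contDiffOn_cocycle {n : ℕ} (hM : ∀ ε, MarkovAlong θ (X ε).law ω)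
    (hc : ∀ t < n, ∀ i j,
      ContDiffOn ℝ ℓ (fun ε : ℝ => (X ε.toNNReal).cocycle 1 (θ^[t] ω) i j) (Icc 0 ε₀))
    (i j : Fin k) :
    ContDiffOn ℝ ℓ (fun ε : ℝ => (X ε.toNNReal).cocycle n ω i j) (Icc 0 ε₀) := by
  induction n generalizing i with
  | zero =>
    simp only [(hM _).cocycle_zero]
    exact contDiffOn_const
  | succ n ih =>
    simp only [(hM _).cocycle_succ, Matrix.mul_apply]
    exact ContDiffOn.sum fun s _ => (hc n n.lt_succ_self i s).mul
      (ih (fun t ht => hc t (ht.trans n.lt_succ_self)) s)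

theorem contDiffOn_cocycle_pullback (h : ∀ n, IsExpandable X J N ε₀ ℓ (θ.symm^[n] ω)) (n : ℕ)
    (i j : Fin k) :
    ContDiffOn ℝ ℓ (fun ε : ℝ => (X ε.toNNReal).cocycle n (θ.symm^[n] ω) i j) (Icc 0 ε₀) := by
  refine contDiffOn_cocycle (h n).markovAlong (fun t ht => ?_) i j
  obtain ⟨d, rfl⟩ := Nat.exists_eq_add_of_lt ht
  have : θ^[t] (θ.symm^[t + d + 1] ω) = θ.symm^[d + 1] ω := by
    rw [show t + d + 1 = (d + 1) + t by ring, iterate_symm_iterate_add]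
  rw [this]
  exact (h _).contDiffOn

theorem isLittleO_cocycle_column (hε₀ : 0 < ε₀) (hℓ : 1 ≤ ℓ)
    (h : ∀ n, IsExpandable X J N ε₀ ℓ (θ.symm^[n] ω)) (i : Fin k) :
    (fun ε : ℝ => (X ε.toNNReal).cocycle (N ω) (θ.symm^[N ω] ω) i (J (θ.symm^[N ω] ω)) -
      (if i = J ω then 1 else 0) - ε ^ ℓ * (qCoeff X J N ℓ ω i / ℓ.factorial))
      =o[𝓝[≥] 0] fun ε => ε ^ ℓ := by
  have hz := (h (N ω)).qCoeff_eq_zero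
  have h1 := isLittleO_sub_of_iteratedDerivWithin_eq_zero hε₀ hℓ
    (contDiffOn_cocycle_pullback h (N ω) i (J (θ.symm^[N ω] ω))) fun n hn hn' => by
      rw [← qCoeff_eq_iteratedDerivWithin hn fun s hs hs' => hz s hs (hs'.trans hn')]
      exact congrFun ((h 0).qCoeff_eq_zero n hn hn') i
  rw [← qCoeff_eq_iteratedDerivWithin hℓ hz, Real.toNNReal_zero] at h1
  have h0 := (h 0).cocycle_zero i (J (θ.symm^[N ω] ω))
  rw [Function.iterate_zero_apply] at h0
  rwa [h0] at h1

theorem isBigO_cocycle_sub (hε₀ : 0 < ε₀) (hℓ : 1 ≤ ℓ)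
    (h : ∀ n, IsExpandable X J N ε₀ ℓ (θ.symm^[n] ω)) (n : ℕ) (i j : Fin k) :
    (fun ε : ℝ => (X ε.toNNReal).cocycle n (θ.symm^[n] ω) i j -
      (X (0 : ℝ).toNNReal).cocycle n (θ.symm^[n] ω) i j) =O[𝓝[≥] 0] fun ε => ε := by
  have hd := (contDiffOn_cocycle_pullback h n i j).differentiableOn
    (by exact_mod_cast (by omega : ℓ ≠ 0)) 0 (left_mem_Icc.2 hε₀.le)
  have := hd.isBigO_sub
  rw [nhdsWithin_Icc_eq_nhdsGE hε₀] at this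
  simpa only [sub_zero] using this

/-- If `P_ε(L, θ^{-L} ω⁻)` is known to map everything to `e_(J(ω⁻))` up to an error of order `h`,
then prefixing it to `P_ε(N(ω), ω⁻)` gains one order. -/
theorem isBigO_cocycle_add (hε₀ : 0 < ε₀) (hℓ : 1 ≤ ℓ)
    (h : ∀ n, IsExpandable X J N ε₀ ℓ (θ.symm^[n] ω)) {L r : ℕ}
    (hL : ∀ i j, (fun ε : ℝ => (X ε.toNNReal).cocycle L (θ.symm^[L] (θ.symm^[N ω] ω)) i j -
      if i = J (θ.symm^[N ω] ω) then 1 else 0) =O[𝓝[≥] 0] fun ε => ε ^ r) (i j : Fin k) :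
    (fun ε : ℝ => (X ε.toNNReal).cocycle (N ω + L) (θ.symm^[N ω + L] ω) i j -
      (X ε.toNNReal).cocycle (N ω) (θ.symm^[N ω] ω) i (J (θ.symm^[N ω] ω)))
      =O[𝓝[≥] 0] fun ε => ε ^ (r + 1) := by
  have hit : θ.symm^[L] (θ.symm^[N ω] ω) = θ.symm^[N ω + L] ω := by
    rw [add_comm, Function.iterate_add_apply]
  rw [hit] at hL
  simp only [MRN.cocycle_pullback_add fun n => (h n).markovAlong _]
  refine isBigO_mul_sub_column (A := fun ε : ℝ => (X ε.toNNReal).cocycle (N ω) (θ.symm^[N ω] ω))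
    (B := fun ε : ℝ => (X ε.toNNReal).cocycle L (θ.symm^[N ω + L] ω)) (J := J ω) ?_
    (isBigO_cocycle_sub hε₀ hℓ h _) hL
    (fun ε j => ((h _).markovAlong _).sum_cocycle L j) i j
  rw [Real.toNNReal_zero]
  exact (h 0).cocycle_zero

theorem exists_isBigO_cocycle (hε₀ : 0 < ε₀) (hℓ : 1 ≤ ℓ)
    (h : ∀ n, IsExpandable X J N ε₀ ℓ (θ.symm^[n] ω)) {r : ℕ} (hr : r ≤ ℓ) :
    ∃ L, ∀ i j, (fun ε : ℝ => (X ε.toNNReal).cocycle L (θ.symm^[L] ω) i j -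
      if i = J ω then 1 else 0) =O[𝓝[≥] 0] fun ε => ε ^ r := by
  induction r generalizing ω with
  | zero =>
    refine ⟨0, fun i j => ?_⟩
    simp only [((h 0).markovAlong _).cocycle_zero, pow_zero]
    exact isBigO_const_const _ one_ne_zero _
  | succ r ih =>
    obtain ⟨L, hL⟩ := ih (ω := θ.symm^[N ω] ω)
      (fun n => by rw [← Function.iterate_add_apply]; exact h _) (by omega)
    refine ⟨N ω + L, fun i j => ?_⟩
    have h1 := isBigO_cocycle_add hε₀ hℓ h hL i j
    have h2 : (fun ε : ℝ => ε ^ ℓ) =O[𝓝[≥] 0] fun ε : ℝ => ε ^ (r + 1) := by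
      rcases hr.eq_or_lt with rfl | hr
      · exact isBigO_refl _ _
      · exact ((isLittleO_pow_pow hr).mono nhdsWithin_le_nhds).isBigO
    have h3 : (fun ε : ℝ => ε ^ ℓ * (qCoeff X J N ℓ ω i / ℓ.factorial)) =O[𝓝[≥] 0]
        fun ε : ℝ => ε ^ ℓ := by
      simpa only [mul_comm] using isBigO_const_mul_self (qCoeff X J N ℓ ω i / ℓ.factorial)
        (fun ε : ℝ => ε ^ ℓ) (𝓝[≥] 0)
    refine (h1.add (((isLittleO_cocycle_column hε₀ hℓ h i).isBigO.add h3).trans h2)).congr_left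
      fun ε => ?_
    ring

/-- Whatever the initial state, the law of the perturbed network at `ω`, if started sufficiently
long ago, is `e_(J(ω)) + ε^ℓ q^(ℓ)(ω) / ℓ!` up to an error `o(ε^ℓ)`. -/
theorem exists_isLittleO_cocycle (hε₀ : 0 < ε₀) (hℓ : 1 ≤ ℓ)
    (h : ∀ n, IsExpandable X J N ε₀ ℓ (θ.symm^[n] ω)) :
    ∃ L, ∀ i j, (fun ε : ℝ => (X ε.toNNReal).cocycle L (θ.symm^[L] ω) i j -
      (if i = J ω then 1 else 0) - ε ^ ℓ * (qCoeff X J N ℓ ω i / ℓ.factorial))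
      =o[𝓝[≥] 0] fun ε => ε ^ ℓ := by
  obtain ⟨L, hL⟩ := exists_isBigO_cocycle (ω := θ.symm^[N ω] ω) hε₀ hℓ
    (fun n => by rw [← Function.iterate_add_apply]; exact h _) le_rfl
  refine ⟨N ω + L, fun i j => ?_⟩
  have h1 := isBigO_cocycle_add hε₀ hℓ h hL i j
  have h2 : (fun ε : ℝ => ε ^ (ℓ + 1)) =o[𝓝[≥] 0] fun ε : ℝ => ε ^ ℓ :=
    (isLittleO_pow_pow (Nat.lt_succ_self ℓ)).mono nhdsWithin_le_nhds
  refine ((h1.trans_isLittleO h2).add (isLittleO_cocycle_column hε₀ hℓ h i)).congr_left fun ε => ?_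
  ring

end expansion

/-! ### Existence of a synchronization index and of a pull-back synchronization time -/

theorem ae_forall_iterate {T : Ω → Ω} (hT : MeasurePreserving T μ μ) {p : Ω → Prop}
    (h : ∀ᵐ ω ∂μ, p ω) : ∀ᵐ ω ∂μ, ∀ n, p (T^[n] ω) :=
  ae_all_iff.2 fun n => (hT.iterate n).quasiMeasurePreserving.ae h

theorem MarkovAlong.cocycle_eq_ite {X : MRN k μ θ} {ω : Ω} (h : MarkovAlong θ X.law ω) {n : ℕ}
    {i j : Fin k} (hij : X.cocycle n ω i j = 1) (s : Fin k) :
    X.cocycle n ω s j = if s = i then 1 else 0 := by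
  split_ifs with hs
  · rw [hs, hij]
  · have h1 := h.sum_cocycle n j
    rw [← Finset.add_sum_erase _ _ (Finset.mem_univ i), hij, add_eq_left] at h1
    exact (Finset.sum_eq_zero_iff_of_nonneg fun s _ => X.cocycle_nonneg n ω s j).1 h1 s
      (Finset.mem_erase.2 ⟨hs, Finset.mem_univ s⟩)

theorem MarkovAlong.mulVec_single_eq {X : MRN k μ θ} {ω : Ω} (h : MarkovAlong θ X.law ω) {n : ℕ}
    {i j : Fin k} (hij : X.cocycle n ω i j = 1) :
    X.cocycle n ω *ᵥ Pi.single j 1 = Pi.single i 1 := by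
  ext s
  rw [Matrix.mulVec_single_one, Matrix.col_apply, h.cocycle_eq_ite hij, Pi.single_apply]

theorem MarkovAlong.cocycle_le_one {X : MRN k μ θ} {ω : Ω} (h : MarkovAlong θ X.law ω) (n : ℕ)
    (i j : Fin k) : X.cocycle n ω i j ≤ 1 :=
  (Finset.single_le_sum (fun s _ => X.cocycle_nonneg n ω s j) (Finset.mem_univ i)).trans_eq
    (h.sum_cocycle n j)

theorem ae_eventually_exists_cocycle_eq_one {X₀ : MRN k μ θ} (hk : 0 < k)
    (hdet : X₀.IsDeterministic) (hsync : X₀.IsSynchronized) :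
    ∀ᵐ ω ∂μ, ∀ᶠ n in atTop, ∃ i, ∀ j, X₀.cocycle n ω i j = 1 := by
  obtain ⟨N, -, hN⟩ := hsync
  filter_upwards [hN, hdet, X₀.markovAlong] with ω hNω hd hM
  refine eventually_atTop.2 ⟨N ω, fun n hn => ?_⟩
  have hspec : ∀ j, X₀.cocycle n ω (X₀.stateMap n ω j) j = 1 := by
    intro j
    refine @Classical.epsilon_spec_aux (Fin k) ⟨j⟩ (fun i => X₀.cocycle n ω i j = 1) ?_
    by_contra! hne
    have h1 := hM.sum_cocycle n j
    rw [Finset.sum_eq_zero fun i _ => (hd n i j).resolve_right (hne i)] at h1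
    exact zero_ne_one h1
  refine ⟨X₀.stateMap n ω ⟨0, hk⟩, fun j => ?_⟩
  rw [hNω n hn ⟨0, hk⟩ j]
  exact hspec j

/-- Since `θ` preserves `μ`, synchronization forward in time, which holds at time `n` with a
probability that tends to one, entails synchronization along pulled back orbits. -/
theorem ae_exists_cocycle_pullback_eq_one [IsProbabilityMeasure μ]
    (hθ : MeasurePreserving θ μ μ) {X₀ : MRN k μ θ} (hk : 0 < k)
    (hdet : X₀.IsDeterministic) (hsync : X₀.IsSynchronized) :
    ∀ᵐ ω ∂μ, ∃ i n, ∀ j, X₀.cocycle n (θ.symm^[n] ω) i j = 1 := by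
  have hC := ae_eventually_exists_cocycle_eq_one hk hdet hsync
  have hm : ∀ n, MeasurableSet {ω | ∃ i, ∀ j, X₀.cocycle n ω i j = 1} := by
    intro n
    simp only [ofPred_exists, ofPred_forall]
    exact .iUnion fun i => .iInter fun j =>
      X₀.measurable_cocycle n i j (measurableSet_singleton 1)
  have hsymm := hθ.symm
  set S : Set Ω := {ω | ∃ i n, ∀ j, X₀.cocycle n (θ.symm^[n] ω) i j = 1} with hS
  have hSm : MeasurableSet S := by
    simp only [hS, ofPred_exists, ofPred_forall]
    exact .iUnion fun i => .iUnion fun n => .iInter fun j =>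
      ((X₀.measurable_cocycle n i j).comp (θ.symm.measurable.iterate n))
        (measurableSet_singleton 1)
  have h1 : μ.real {ω | ∀ᶠ n in atTop, ω ∈ {ω | ∃ i, ∀ j, X₀.cocycle n ω i j = 1}} = 1 := by
    rw [measureReal_def, (prob_compl_eq_zero_iff (measurableSet_eventually_mem hm)).1
      (mem_ae_iff.1 hC), ENNReal.toReal_one]
  have h2 : 1 ≤ μ.real S := by
    refine le_of_forall_lt fun c hc => ?_
    obtain ⟨n, hn⟩ := (eventually_lt_measureReal_inter (hc.trans_eq h1.symm)).exists
    refine hn.trans_le ((measureReal_mono inter_subset_left).trans ?_)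
    rw [measureReal_def, ← (hsymm.iterate n).measure_preimage (hm n).nullMeasurableSet]
    exact measureReal_mono fun ω ⟨i, hi⟩ => ⟨i, n, hi⟩
  have h3 : μ S = 1 := by
    rw [← ENNReal.ofReal_toReal (measure_ne_top μ S), ← measureReal_def,
      le_antisymm measureReal_le_one h2, ENNReal.ofReal_one]
  exact mem_ae_iff.2 ((prob_compl_eq_zero_iff hSm).2 h3)

theorem exists_isSyncIndex_isPullbackSyncTime [MeasurableSingletonClass Ω] [IsProbabilityMeasure μ]
    (hθ : MeasurePreserving θ μ μ) {X₀ : MRN k μ θ} (hk : 0 < k)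
    (hdet : X₀.IsDeterministic) (hsync : X₀.IsSynchronized) :
    ∃ (J : Ω → Fin k) (N : Ω → ℕ), X₀.IsSyncIndex J ∧ X₀.IsPullbackSyncTime J N := by
  classical
  have : Nonempty (Fin k) := ⟨⟨0, hk⟩⟩
  have hsymm := hθ.symm
  have hPm : ∀ i n, MeasurableSet {ω | ∀ j, X₀.cocycle n (θ.symm^[n] ω) i j = 1} := by
    intro i n
    simp only [ofPred_forall]
    exact .iInter fun j => ((X₀.measurable_cocycle n i j).comp (θ.symm.measurable.iterate n))
        (measurableSet_singleton 1)
  -- The index is chosen from the set of candidates by a map on the finite space `Set (Fin k)`,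
  -- which makes it measurable.
  let R : Ω → Set (Fin k) := fun ω => {i | ∃ n, ∀ j, X₀.cocycle n (θ.symm^[n] ω) i j = 1}
  have hR : Measurable R := by
    refine measurable_set_iff.2 fun i => measurableSet_setOfPred.1 ?_
    have hi : MeasurableSet {ω | ∃ n, ∀ j, X₀.cocycle n (θ.symm^[n] ω) i j = 1} := by
      simp only [ofPred_exists]
      exact .iUnion fun n => hPm i n
    exact hi
  let c : Set (Fin k) → Fin k := fun s => Classical.epsilon fun i => i ∈ s
  let J : Ω → Fin k := fun ω => c (R ω)
  have hJ : Measurable J := (measurable_of_finite c).comp hR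
  have hPJm : ∀ n, MeasurableSet {ω | ∀ j, X₀.cocycle n (θ.symm^[n] ω) (J ω) j = 1} := by
    intro n
    have : {ω | ∀ j, X₀.cocycle n (θ.symm^[n] ω) (J ω) j = 1} =
        ⋃ i, J ⁻¹' {i} ∩ {ω | ∀ j, X₀.cocycle n (θ.symm^[n] ω) i j = 1} := by
      ext ω
      simp
    rw [this]
    exact .iUnion fun i => (hJ (measurableSet_singleton i)).inter (hPm i n)
  let p : Ω → ℕ → Prop := fun ω n => (∃ n, ∀ j, X₀.cocycle n (θ.symm^[n] ω) (J ω) j = 1) →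
    ∀ j, X₀.cocycle n (θ.symm^[n] ω) (J ω) j = 1
  have hp : ∀ ω, ∃ n, p ω n := by
    intro ω
    by_cases h : ∃ n, ∀ j, X₀.cocycle n (θ.symm^[n] ω) (J ω) j = 1
    · exact h.imp fun n hn _ => hn
    · exact ⟨0, fun h' => absurd h' h⟩
  have hN : Measurable fun ω => Nat.find (hp ω) := by
    refine measurable_find hp fun n => ?_
    refine MeasurableSet.imp ?_ (hPJm n)
    simp only [ofPred_exists]
    exact .iUnion hPJm
  have hmain : ∀ᵐ ω ∂μ, ∀ n, Nat.find (hp ω) ≤ n → ∀ j,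
      X₀.cocycle n (θ.symm^[n] ω) (J ω) j = 1 := by
    filter_upwards [ae_exists_cocycle_pullback_eq_one hθ hk hdet hsync,
      ae_forall_iterate hsymm X₀.markovAlong] with ω hω hM n hn j
    have h1 := Nat.find_spec (hp ω) (Classical.epsilon_spec (p := fun i => i ∈ R ω) hω)
    have h2 := MRN.cocycle_mem_Icc_of_le hn hM (a := 1) (b := 1) (i := J ω)
      (fun j => by rw [h1 j]; simp) j
    exact le_antisymm h2.2 h2.1
  refine ⟨J, fun ω => Nat.find (hp ω), ⟨hJ, ?_⟩, hN, ?_⟩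
  · filter_upwards [hmain, ae_forall_iterate hθ hmain, ae_forall_iterate hθ
      (ae_forall_iterate hsymm X₀.markovAlong)] with ω h0 hit hM n
    set M := max (Nat.find (hp ω)) (Nat.find (hp (θ^[n] ω))) with hMdef
    have hpt : θ.symm^[n + M] (θ^[n] ω) = θ.symm^[M] ω := by
      rw [add_comm, Function.iterate_add_apply, symm_iterate_iterate]
    let j : Fin k := ⟨0, hk⟩
    have h1 := (hM n (n + M)).mulVec_single_eq (hit n (n + M) (by omega) j)
    have h2 := (hM 0 M).mulVec_single_eq (h0 M (by omega) j)
    rw [Function.iterate_zero_apply] at h2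
    rw [MRN.cocycle_pullback_add (hM n), hpt, symm_iterate_iterate, ← Matrix.mulVec_mulVec, h2]
      at h1
    exact h1
  · filter_upwards [hmain, ae_forall_iterate hsymm X₀.markovAlong] with ω hω hM j n hn
    exact (hM n).mulVec_single_eq (hω n hn j)

/-! ### Noise realizations with uniform bounds -/

/-- The realizations `ω` for which all entries in the row `J(ω)` of `P_ε(K, θ^{-K} ω)` lie between
`lo K ε` and `hi K ε`, for all rational `0 < ε < 1 / (K + 1)`. The restriction to rational `ε`
makes the set measurable. -/
def uniformBoundSet (X : ℝ≥0 → MRN k μ θ) (J : Ω → Fin k) (lo hi : ℕ → ℝ → ℝ) (K : ℕ) : Set Ω :=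
  {ω | ∀ q : ℚ, 0 < (q : ℝ) → (q : ℝ) < 1 / (K + 1) → ∀ j,
    (X (q : ℝ).toNNReal).cocycle K (θ.symm^[K] ω) (J ω) j ∈ Icc (lo K q) (hi K q)}

theorem measurableSet_uniformBoundSet (X : ℝ≥0 → MRN k μ θ) {J : Ω → Fin k} (hJ : Measurable J)
    (lo hi : ℕ → ℝ → ℝ) (K : ℕ) : MeasurableSet (uniformBoundSet X J lo hi K) := by
  simp only [uniformBoundSet, ofPred_forall]
  refine .iInter fun q => .iInter fun _ => .iInter fun _ => .iInter fun j => ?_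
  have h : Measurable fun z : Fin k × Ω =>
      (X (q : ℝ).toNNReal).cocycle K (θ.symm^[K] z.2) z.1 j :=
    measurable_from_prod_countable_right fun i =>
      ((X _).measurable_cocycle K i j).comp (θ.symm.measurable.iterate K)
  exact (h.comp (hJ.prodMk measurable_id)) measurableSet_Icc

theorem le_of_forall_rat_le {f g : ℝ → ℝ} {b : ℝ} (hf : ContinuousOn f (Icc 0 b))
    (hg : ContinuousOn g (Icc 0 b)) (hb : 0 < b)
    (h : ∀ q : ℚ, 0 < (q : ℝ) → (q : ℝ) < b → f q ≤ g q) {x : ℝ} (hx : x ∈ Icc 0 b) :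
    f x ≤ g x := by
  have hsub : Ioo 0 b ∩ range ((↑) : ℚ → ℝ) ⊆ Icc 0 b :=
    inter_subset_left.trans Ioo_subset_Icc_self
  have hcl : x ∈ closure (Ioo 0 b ∩ range ((↑) : ℚ → ℝ)) := by
    have h1 := closure_mono (Rat.denseRange_cast.open_subset_closure_inter
      (isOpen_Ioo (a := (0 : ℝ)) (b := b)))
    rw [closure_closure, closure_Ioo hb.ne] at h1
    exact h1 hx
  refine ((hf x hx).mono hsub).closure_le hcl ((hg x hx).mono hsub) ?_
  rintro _ ⟨hq, q, rfl⟩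
  exact h q hq.1 hq.2

section bounds

variable [MeasurableSingletonClass Ω] {X : ℝ≥0 → MRN k μ θ} {J : Ω → Fin k} {N : Ω → ℕ}
  {ε₀ : ℝ} {ℓ : ℕ} {ω : Ω} {lo hi : ℕ → ℝ → ℝ}

theorem eventually_mem_uniformBoundSet {a b : ℝ → ℝ} {L : ℕ}
    (h : ∀ n ε, MarkovAlong θ (X ε).law (θ.symm^[n] ω))
    (hL : ∀ᶠ ε : ℝ in 𝓝[≥] 0, ∀ j,
      (X ε.toNNReal).cocycle L (θ.symm^[L] ω) (J ω) j ∈ Icc (a ε) (b ε))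
    (hab : ∀ᶠ K in atTop, ∀ ε : ℝ, 0 < ε → lo K ε ≤ a ε ∧ b ε ≤ hi K ε) :
    ∀ᶠ K in atTop, ω ∈ uniformBoundSet X J lo hi K := by
  obtain ⟨ε₁, hε₁, hL⟩ := mem_nhdsGE_iff_exists_Ico_subset.1 hL
  have hε₁' : ∀ᶠ K : ℕ in atTop, 1 / ((K : ℝ) + 1) < ε₁ :=
    tendsto_one_div_add_atTop_nhds_zero_nat.eventually_lt_const hε₁
  filter_upwards [hab, hε₁', eventually_ge_atTop L] with K hK hK' hLK q hq hqK j
  have h1 := MRN.cocycle_mem_Icc_of_le hLK (fun n => h n _)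
    (hL ⟨hq.le, hqK.trans hK'⟩) j
  exact ⟨(hK q hq).1.trans h1.1, h1.2.trans (hK q hq).2⟩

theorem sum_cocycle_mul_mem_Icc_of_mem_uniformBoundSet (hε₀ : 0 < ε₀)
    (h : ∀ n, IsExpandable X J N ε₀ ℓ (θ.symm^[n] ω)) {K n : ℕ} (hKn : K ≤ n)
    (hω : ω ∈ uniformBoundSet X J lo hi K) (hlo : Continuous (lo K)) (hhi : Continuous (hi K))
    {ε : ℝ≥0} (hε : (ε : ℝ) < min (1 / ((K : ℝ) + 1)) ε₀) {π : Fin k → ℝ}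
    (hπ : π ∈ stdSimplex ℝ (Fin k)) :
    ∑ j, (X ε).cocycle n (θ.symm^[n] ω) (J ω) j * π j ∈ Icc (lo K ε) (hi K ε) := by
  refine MRN.sum_cocycle_mul_mem_Icc hKn (fun n => (h n).markovAlong ε) (fun j => ?_) hπ
  have hb : 0 < min (1 / ((K : ℝ) + 1)) ε₀ := lt_min (by positivity) hε₀
  have hmem : (ε : ℝ) ∈ Icc 0 (min (1 / ((K : ℝ) + 1)) ε₀) := ⟨ε.2, hε.le⟩
  have hc := ((contDiffOn_cocycle_pullback h K (J ω) j).continuousOn).mono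
    (Icc_subset_Icc_right (min_le_right (1 / ((K : ℝ) + 1)) ε₀))
  have h1 := le_of_forall_rat_le hlo.continuousOn hc hb
    (fun q hq hq' => (hω q hq (hq'.trans_le (min_le_left _ _)) j).1) hmem
  have h2 := le_of_forall_rat_le hc hhi.continuousOn hb
    (fun q hq hq' => (hω q hq (hq'.trans_le (min_le_left _ _)) j).2) hmem
  simp only [Real.toNNReal_coe] at h1 h2
  exact ⟨h1, h2⟩

theorem eventually_mem_uniformBoundSet_sync (hε₀ : 0 < ε₀) (hℓ : 1 ≤ ℓ)
    (h : ∀ n, IsExpandable X J N ε₀ ℓ (θ.symm^[n] ω)) :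
    ∀ᶠ K in atTop, ω ∈ uniformBoundSet X J (fun K ε => 1 - (K + 1) * ε ^ ℓ) (fun _ _ => 1) K := by
  obtain ⟨L, hL⟩ := exists_isLittleO_cocycle hε₀ hℓ h
  set c := qCoeff X J N ℓ ω (J ω) / ℓ.factorial
  refine eventually_mem_uniformBoundSet (L := L) (a := fun ε => 1 - (|c| + 1) * ε ^ ℓ)
    (b := fun _ => 1) (fun n => (h n).markovAlong) ?_ ?_
  · filter_upwards [eventually_all.2 fun j => (hL (J ω) j).def one_pos, self_mem_nhdsWithin]
      with ε hε hε' j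
    have hpow : 0 ≤ ε ^ ℓ := pow_nonneg hε' _
    have h1 := hε j
    rw [if_pos rfl, one_mul, Real.norm_eq_abs, Real.norm_of_nonneg hpow] at h1
    refine ⟨?_, ((h L).markovAlong _).cocycle_le_one _ _ _⟩
    nlinarith [(abs_le.1 h1).1, mul_le_mul_of_nonneg_left (neg_abs_le c) hpow]
  · obtain ⟨K₀, hK₀⟩ := exists_nat_ge |c|
    filter_upwards [eventually_ge_atTop K₀] with K hK ε hε
    refine ⟨?_, le_rfl⟩
    have : (K₀ : ℝ) ≤ K := by exact_mod_cast hK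
    have := mul_le_mul_of_nonneg_right (show |c| + 1 ≤ (K : ℝ) + 1 by linarith)
      (pow_nonneg hε.le ℓ)
    linarith

theorem eventually_mem_uniformBoundSet_desync (hε₀ : 0 < ε₀) (hℓ : 1 ≤ ℓ)
    (h : ∀ n, IsExpandable X J N ε₀ ℓ (θ.symm^[n] ω)) (hq : qCoeff X J N ℓ ω ≠ 0) :
    ∀ᶠ K in atTop,
      ω ∈ uniformBoundSet X J (fun _ _ => 1 / 2) (fun K ε => 1 - 1 / (K + 1) * ε ^ ℓ) K := by
  obtain ⟨L, hL⟩ := exists_isLittleO_cocycle hε₀ hℓ h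
  have hc : qCoeff X J N ℓ ω (J ω) / ℓ.factorial < 0 := by
    refine leading_coeff_neg (J := J ω) (c := fun i => qCoeff X J N ℓ ω i / ℓ.factorial)
      (fun ε i => (X ε.toNNReal).cocycle_nonneg L (θ.symm^[L] ω) i (J ω))
      (fun ε => ((h L).markovAlong _).sum_cocycle L (J ω)) (fun i => hL i (J ω)) fun h0 => hq ?_
    funext i
    have h1 := congrFun h0 i
    simpa [ℓ.factorial_ne_zero] using h1
  set c := qCoeff X J N ℓ ω (J ω) / ℓ.factorial
  refine eventually_mem_uniformBoundSet (L := L) (a := fun ε => 1 / 2)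
    (b := fun ε => 1 + c / 2 * ε ^ ℓ) (fun n => (h n).markovAlong) ?_ ?_
  · have hsmall : ∀ᶠ ε : ℝ in 𝓝[≥] 0, -c * 2 * ε ^ ℓ < 1 / 2 := by
      refine Tendsto.eventually_lt_const (v := 0) (by norm_num) ?_
      have : Continuous fun ε : ℝ => -c * 2 * ε ^ ℓ := by fun_prop
      have h0 := (this.tendsto 0).mono_left (nhdsWithin_le_nhds (s := Ici 0))
      rwa [zero_pow (by omega), mul_zero] at h0
    filter_upwards [eventually_all.2 fun j => (hL (J ω) j).def (show 0 < -c / 2 by linarith),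
      self_mem_nhdsWithin, hsmall] with ε hε hε' hs j
    have hpow : 0 ≤ ε ^ ℓ := pow_nonneg hε' _
    have h1 := hε j
    rw [if_pos rfl, Real.norm_eq_abs, Real.norm_of_nonneg hpow] at h1
    have h2 := abs_le.1 h1
    have h3 : 0 ≤ -c * ε ^ ℓ := mul_nonneg (by linarith) hpow
    exact ⟨by linarith [h2.1], by linarith [h2.2]⟩
  · have h1 : ∀ᶠ K : ℕ in atTop, 1 / ((K : ℝ) + 1) < -c / 2 :=
      tendsto_one_div_add_atTop_nhds_zero_nat.eventually_lt_const (by linarith)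
    filter_upwards [h1] with K hK ε hε
    refine ⟨le_rfl, ?_⟩
    have := mul_le_mul_of_nonneg_right hK.le (pow_nonneg hε.le ℓ)
    linarith

end bounds

/-! ### Perturbations of synchronized deterministic networks -/

theorem IsMarkovPerturbation.ae_cocycle_zero_eq [MeasurableSingletonClass Ω]
    (hθ : MeasurePreserving θ μ μ) {X : ℝ≥0 → MRN k μ θ} {X₀ : MRN k μ θ}
    (hX : IsMarkovPerturbation X X₀) :
    ∀ᵐ ω ∂μ, ∀ n, (X 0).cocycle n ω = X₀.cocycle n ω := by
  have hone : ∀ᵐ ω ∂μ, (X 0).cocycle 1 ω = X₀.cocycle 1 ω := by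
    filter_upwards [hX.bound] with ω hω
    ext i j
    have h1 : ∑ i, |((X 0).cocycle 1 ω - X₀.cocycle 1 ω) i j| ≤ 0 :=
      (le_ciSup (finite_range fun j => ∑ i, |((X 0).cocycle 1 ω - X₀.cocycle 1 ω) i j|).bddAbove
        j).trans (hω 0)
    have h2 := (Finset.single_le_sum (fun i _ => abs_nonneg (((X 0).cocycle 1 ω -
      X₀.cocycle 1 ω) i j)) (Finset.mem_univ i)).trans h1
    exact sub_eq_zero.1 (abs_nonpos_iff.1 h2)
  filter_upwards [ae_forall_iterate hθ hone, hX.markovAlong, X₀.markovAlong] with ω h1 hM hM₀ n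
  induction n with
  | zero => rw [(hM 0).cocycle_zero, hM₀.cocycle_zero]
  | succ n ih => rw [(hM 0).cocycle_succ, hM₀.cocycle_succ, ih, h1 n]

theorem ae_forall_isExpandable [MeasurableSingletonClass Ω] (hθ : MeasurePreserving θ μ μ)
    {X : ℝ≥0 → MRN k μ θ} {X₀ : MRN k μ θ} (hX : IsMarkovPerturbation X X₀)
    {J : Ω → Fin k} {N : Ω → ℕ} (hN : X₀.IsPullbackSyncTime J N) {ε₀ : ℝ} {ℓ m : ℕ} (hℓm : ℓ ≤ m)
    (hc : ∀ᵐ ω ∂μ, ∀ i j : Fin k,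
      ContDiffOn ℝ m (fun ε : ℝ => (X ε.toNNReal).cocycle 1 ω i j) (Icc 0 ε₀))
    (hq : ∀ i, 1 ≤ i → i < ℓ → ∀ᵐ ω ∂μ, qCoeff X J N i ω = 0) :
    ∀ᵐ ω ∂μ, ∀ n, IsExpandable X J N ε₀ ℓ (θ.symm^[n] ω) := by
  refine ae_forall_iterate hθ.symm ?_
  have hq' : ∀ᵐ ω ∂μ, ∀ i, 1 ≤ i → i < ℓ → qCoeff X J N i ω = 0 :=
    ae_all_iff.2 fun i => by
      by_cases hi : 1 ≤ i ∧ i < ℓ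
      · filter_upwards [hq i hi.1 hi.2] with ω hω _ _ using hω
      · exact .of_forall fun ω h1 h2 => absurd ⟨h1, h2⟩ hi
  filter_upwards [hX.markovAlong, hc, hq', hN.2,
    ae_forall_iterate hθ.symm (hX.ae_cocycle_zero_eq hθ)] with ω h1 h2 h3 h4 h5
  refine ⟨h1, fun i j => (h2 i j).of_le (by exact_mod_cast hℓm), fun i j => ?_, h3⟩
  have h6 := congrFun (h4 j (N ω) le_rfl) i
  rwa [Matrix.mulVec_single_one, Matrix.col_apply, Pi.single_apply, ← h5] at h6

theorem exists_first_nonzero_order {X : ℝ≥0 → MRN k μ θ} {J : Ω → Fin k} {N : Ω → ℕ} {m : ℕ}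
    [IsProbabilityMeasure μ] (hdeg : μ (degenerateSet X J N m) < 1) :
    ∃ ℓ, 1 ≤ ℓ ∧ ℓ ≤ m ∧ (¬ ∀ᵐ ω ∂μ, qCoeff X J N ℓ ω = 0) ∧
      ∀ i, 1 ≤ i → i < ℓ → ∀ᵐ ω ∂μ, qCoeff X J N i ω = 0 := by
  classical
  have hex : ∃ ℓ, 1 ≤ ℓ ∧ ℓ ≤ m ∧ ¬ ∀ᵐ ω ∂μ, qCoeff X J N ℓ ω = 0 := by
    by_contra! h
    refine hdeg.ne ?_
    have h1 : degenerateSet X J N m =ᵐ[μ] univ := by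
      rw [eventuallyEq_univ]
      refine ae_all_iff.2 fun ℓ => ?_
      by_cases hi : 1 ≤ ℓ ∧ ℓ ≤ m
      · filter_upwards [h ℓ hi.1 hi.2] with ω hω _ _ using hω
      · exact .of_forall fun ω h1 h2 => absurd ⟨h1, h2⟩ hi
    rw [measure_congr h1, measure_univ]
  obtain ⟨h1, h2, h3⟩ := Nat.find_spec hex
  refine ⟨Nat.find hex, h1, h2, h3, fun i hi hi' => ?_⟩
  by_contra h
  exact Nat.find_min hex hi' ⟨hi, hi'.le.trans h2, h⟩

end

theorem theoremC {Ω : Type*} [MeasurableSpace Ω] [MeasurableSingletonClass Ω]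
    (μ : Measure Ω) [IsProbabilityMeasure μ] (θ : Ω ≃ᵐ Ω) (hθ : Ergodic θ μ)
    (k : ℕ) (hk : 2 ≤ k) (m : ℕ) (hm : 1 ≤ m)
    (X₀ : MRN k μ θ) (hdet : X₀.IsDeterministic) (hsync : X₀.IsSynchronized)
    (X : ℝ≥0 → MRN k μ θ) (hX : IsMarkovPerturbation X X₀) (hXm : IsContDiffFamily m X) :
    (∃ (J : Ω → Fin k) (N : Ω → ℕ), X₀.IsSyncIndex J ∧ X₀.IsPullbackSyncTime J N) ∧
    ∀ (J : Ω → Fin k) (N : Ω → ℕ), X₀.IsSyncIndex J → X₀.IsPullbackSyncTime J N →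
      μ (degenerateSet X J N m) < 1 →
      ∃ (a : ℝ) (ℓ : ℕ), 0 < a ∧ a < 1 ∧ 1 ≤ ℓ ∧ ℓ ≤ m ∧
        ∃ δ₀ : ℝ, 0 < δ₀ ∧ ∀ δ : ℝ, 0 < δ → δ < δ₀ →
          ∃ (εδ b c : ℝ) (E F : Ω → Set ℕ), 0 < εδ ∧ 0 < b ∧ 0 < c ∧
            ∀ᵐ ω ∂μ,
              Disjoint (E ω) (F ω) ∧
              a - δ < lowerDensity (E ω) ∧ 1 - a - δ < lowerDensity (F ω) ∧
              ∀ ε : ℝ≥0, (ε : ℝ) < εδ →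
                ∀ π ∈ stdSimplex ℝ (Fin k), ∀ π' ∈ stdSimplex ℝ (Fin k),
                  (∀ n ∈ E ω, 1 - (ε : ℝ) ^ ℓ * b ≤ (X ε).syncProb π π' ω n) ∧
                  (∀ n ∈ F ω, (ε : ℝ) ^ ℓ * c ≤ (X ε).desyncProb π π' ω n) := by
  refine ⟨exists_isSyncIndex_isPullbackSyncTime hθ.toMeasurePreserving (by omega) hdet hsync,
    fun J N hJ hN hdeg => ?_⟩
  obtain ⟨ε₀, hε₀, hc⟩ := hXm
  obtain ⟨ℓ, hℓ, hℓm, hne, hzero⟩ := exists_first_nonzero_order hdeg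
  have hexp := ae_forall_isExpandable hθ.toMeasurePreserving hX hN hℓm hc hzero
  set A : ℕ → Set Ω :=
    uniformBoundSet X J (fun K ε => 1 - (K + 1) * ε ^ ℓ) (fun _ _ => 1) with hA
  set G : ℕ → Set Ω :=
    uniformBoundSet X J (fun _ _ => 1 / 2) (fun K ε => 1 - 1 / (K + 1) * ε ^ ℓ) with hG
  have hAev : ∀ᵐ ω ∂μ, ∀ᶠ K in atTop, ω ∈ A K := by
    filter_upwards [hexp] with ω hω
    exact eventually_mem_uniformBoundSet_sync hε₀ hℓ hω
  have hGev : ¬ ∀ᵐ ω ∂μ, ¬ ∀ᶠ K in atTop, ω ∈ G K := by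
    refine fun h => hne ?_
    filter_upwards [hexp, h] with ω hω hGω
    by_contra hq
    exact hGω (eventually_mem_uniformBoundSet_desync hε₀ hℓ hω hq)
  obtain ⟨a, ha, ha', h⟩ := exists_disjoint_visit_times hθ
    (measurableSet_uniformBoundSet X hJ.1 _ _) (measurableSet_uniformBoundSet X hJ.1 _ _) hAev hGev
  refine ⟨a, ℓ, ha, ha', hℓ, hℓm, 1, one_pos, fun δ hδ _ => ?_⟩
  obtain ⟨L, E, F, hEF⟩ := h δ hδ
  refine ⟨min (1 / ((L : ℝ) + 1)) ε₀, 2 * (L + 1), 1 / 2 * (1 / (L + 1)), E, F,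
    lt_min (by positivity) hε₀, by positivity, by positivity, ?_⟩
  filter_upwards [hEF, ae_forall_iterate hθ.toMeasurePreserving hexp] with ω hω hr
  refine ⟨hω.1, hω.2.1, hω.2.2.1, fun ε hε π hπ π' hπ' => ⟨fun n hn => ?_, fun n hn => ?_⟩⟩
  · have hb := fun ρ hρ => sum_cocycle_mul_mem_Icc_of_mem_uniformBoundSet hε₀ (hr n)
      (hω.2.2.2.1 n hn).1 (hω.2.2.2.1 n hn).2 (by fun_prop) (by fun_prop) hε (π := ρ) hρ
    simp only [symm_iterate_iterate] at hb
    refine le_trans ?_ ((X ε).mul_le_syncProb hπ hπ' ω n (J (θ^[n] ω)))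
    have h1 := hb π hπ
    have h2 := hb π' hπ'
    nlinarith [mul_nonneg (sub_nonneg.2 h1.2) (sub_nonneg.2 h2.2), h1.1, h2.1]
  · have hb := fun ρ hρ => sum_cocycle_mul_mem_Icc_of_mem_uniformBoundSet hε₀ (hr n)
      (hω.2.2.2.2 n hn).1 (hω.2.2.2.2 n hn).2 (by fun_prop) (by fun_prop) hε (π := ρ) hρ
    simp only [symm_iterate_iterate] at hb
    refine le_trans ?_ ((X ε).mul_le_desyncProb hπ hπ' ω n (J (θ^[n] ω)))
    have h1 : 1 / (L + 1) * (ε : ℝ) ^ ℓ ≤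
        1 - ∑ j, (X ε).cocycle n ω (J (θ^[n] ω)) j * π' j := by linarith [(hb π' hπ').2]
    calc (ε : ℝ) ^ ℓ * (1 / 2 * (1 / (L + 1))) = 1 / 2 * (1 / (L + 1) * (ε : ℝ) ^ ℓ) := by ring
      _ ≤ _ := mul_le_mul (hb π hπ).1 h1 (by positivity) (le_trans (by norm_num) (hb π hπ).1)
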